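/- **Setup.** An $\mathbb R^d$-valued random variable $X$ is $\eta$-HC ($0<\eta<1$) if $\|X\|_4<\infty$ and $\|a+\eta X\|_4\le\|a+X\|_2$ for all $a\in\mathbb R^d$, where $\|X\|_p=\mathbf E[|X|^p]^{1/p}$ and $|\cdot|$ is the Euclidean length. Let $X_1,\dots,X_n$ be independent $\mathbb R^d$-valued $\eta$-HC random variables with $\mathbf E[X_j]=0$ and $\sum_{j=1}^n\mathbf E[X_j[i]^2]=1$ for every coordinate $i\in[d]$. Put $\sigma_j^2=\mathbf E[|X_j|^2]$ and $S=X_1+\cdots+X_n$. Let $G=G_1+\cdots+G_n$ where $G_1,\dots,G_n$ are independent and $G_j$ is a centred $d$-dimensional Gaussian with the same covariance matrix as $X_j$. A finite indexed family $\mathcal H$ of hash functions $h:[n]\to[t]$ is $b$-collision preserving if, for $h$ uniform in $\mathcal H$, $\Pr[h(j)=\ell]\le b/t$ for all $j\in[n]$, $\ell\in[t]$ and $\Pr[h(i)=h(j)]\le b/t$ for all $i\ne j$ in $[n]$. Let $\mathcal H$ be $b$-collision preserving with $b\le 2$. Choose $h\in\mathcal H$ uniformly at random, and then generate $Y_1,\dots,Y_n$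 such that, conditionally on $h$, each $Y_j$ has the same distribution as $X_j$, the variables $(Y_j)_{j:\,h(j)=\ell}$ are 4-wise independent for each bucket $\ell\in[t]$, and the $t$ families $(Y_j)_{j:\,h(j)=\ell}$, $\ell\in[t]$, are independent of one another. Put $T=Y_1+\cdots+Y_n$ (with randomness from both $h$ and the $Y_j$). A set $A\subseteq\mathbb R^d$ is a translate of a union of orthants if there is $\Theta\in\mathbb R^d$ such that membership of $x$ in $A$ depends only on the sign vector $(\mathrm{sgn}(x[i]-\Theta[i]))_{i\in[d]}$, where $\mathrm{sgn}(u)=1$ for $u\ge 0$ and $\mathrm{sgn}(u)=-1$ for $u<0$. **Theorem.** There is a universal constant $C>0$ (independent of $n,d,t,\eta,b$, the family $\mathcal H$ and the distributions) such that, in every such setting and for every translate $A$ of a union of orthants, $$\bigl|\Pr[T\in A]-\Pr[G\in A]\bigr|\le C\,\eta^{-1/2}d^{13/8}\Bigl(\frac{d^2}{t}+\sum_{j=1}^n\sigma_j^4\Bigr)^{1/8}$$ and $$\bigl|\Pr[S\in A]-\Pr[T\in A]\bigr|\le C\,\eta^{-1/2}d^{13/8}\Bigl(\frac{d^2}{t}+\sum_{j=1}^n\sigma_j^4\Bigr)^{1/8}.$$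 -/

import Mathlib

open MeasureTheory ProbabilityTheory

/-- The norm `‖X‖₂²`, that is `E[‖X‖²]`, of a random vector `X`. -/
noncomputable def sqNormL2 {d : ℕ} {Ω : Type*} [MeasurableSpace Ω]
    (X : Ω → EuclideanSpace ℝ (Fin d)) (P : Measure Ω) : ℝ :=
  ∫ ω, ‖X ω‖ ^ 2 ∂P

/-- A random vector `X` is `η`-HC (hypercontractive), `0 < η < 1`, if `‖X‖₄ < ∞` and
`‖a + η X‖₄ ≤ ‖a + X‖₂` for every fixed vector `a`. The inequality is written after raising both
sides to the fourth power; all the integrals are finite because `X` is in `L⁴`. -/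
def IsHC {d : ℕ} {Ω : Type*} [MeasurableSpace Ω]
    (η : ℝ) (X : Ω → EuclideanSpace ℝ (Fin d)) (P : Measure Ω) : Prop :=
  0 < η ∧ η < 1 ∧ MemLp X 4 P ∧
    ∀ a : EuclideanSpace ℝ (Fin d),
      ∫ ω, ‖a + η • X ω‖ ^ 4 ∂P ≤ (∫ ω, ‖a + X ω‖ ^ 2 ∂P) ^ 2

/-- The covariance matrix of a random vector. -/
noncomputable def covMat {d : ℕ} {Ω : Type*} [MeasurableSpace Ω]
    (X : Ω → EuclideanSpace ℝ (Fin d)) (P : Measure Ω) : Matrix (Fin d) (Fin d) ℝ :=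
  Matrix.of fun i k => covariance (fun ω => X ω i) (fun ω => X ω k) P

/-- The sign function with `sgn 0 = 1`. -/
noncomputable def sgn (x : ℝ) : ℝ := if 0 ≤ x then 1 else -1

/-- `A` is a translate of a union of orthants: for some `Θ`, membership of `x` in `A` depends only
on the vector of the signs of the coordinates of `x - Θ`. -/
def IsTranslateOfUnionOfOrthants {d : ℕ} (A : Set (EuclideanSpace ℝ (Fin d))) : Prop :=
  ∃ Θ : EuclideanSpace ℝ (Fin d), ∀ x y : EuclideanSpace ℝ (Fin d),
    (∀ i, sgn ((x - Θ) i) = sgn ((y - Θ) i)) → (x ∈ A ↔ y ∈ A)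

/-- A finite family `hash k`, `k ∈ K`, of functions from `n` points to `t` buckets is
`b`-collision preserving: for a uniformly random member `h` of the family,
`Pr[h j = ℓ] ≤ b / t` for all `j`, `ℓ`, and `Pr[h i = h j] ≤ b / t` for all `i ≠ j`. -/
def IsCollisionPreserving {n t : ℕ} {K : Type*} [Fintype K] (b : ℝ)
    (hash : K → Fin n → Fin t) : Prop :=
  (∀ (j : Fin n) (ℓ : Fin t),
    ((Finset.univ.filter fun k => hash k j = ℓ).card : ℝ) / Fintype.card K ≤ b / t) ∧
  (∀ i j : Fin n, i ≠ j →
    ((Finset.univ.filter fun k => hash k i = hash k j).card : ℝ) / Fintype.card K ≤ b / t)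

/-- The random vectors `Y j`, `j ∈ B`, are `r`-wise independent: any at most `r` of them are
independent. -/
def WiseIndepOn {ι Ω E : Type*} [MeasurableSpace Ω] [MeasurableSpace E] (r : ℕ) (B : Set ι)
    (Y : ι → Ω → E) (P : Measure Ω) : Prop :=
  ∀ J : Finset ι, ↑J ⊆ B → J.card ≤ r → iIndepFun (fun (j : J) ω => Y j ω) P

/-- `Y` is generated from `X` by hashing: a uniformly random member of the family `hash` is chosen
(its index is `seed`); given this choice, every `Y j` has the law of `X j`, the vectors `Y j` with
`j` in one bucket are 4-wise independent, and the tuples of the vectors in the different buckets are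
(fully) independent. -/
structure IsHashedSample {n d t : ℕ} {K Ω Ω' : Type*} [Fintype K]
    [MeasurableSpace Ω] [MeasurableSpace Ω'] (hash : K → Fin n → Fin t)
    (X : Fin n → Ω → EuclideanSpace ℝ (Fin d)) (P : Measure Ω)
    (seed : Ω' → K) (Y : Fin n → Ω' → EuclideanSpace ℝ (Fin d)) (Q : Measure Ω') : Prop where
  measurableSet_seed : ∀ k, MeasurableSet (seed ⁻¹' {k})
  uniform_seed : ∀ k, Q.real (seed ⁻¹' {k}) = 1 / Fintype.card K
  measurable : ∀ j, Measurable (Y j)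
  identDistrib : ∀ k j, IdentDistrib (Y j) (X j) (cond Q (seed ⁻¹' {k})) P
  fourWise : ∀ k ℓ, WiseIndepOn 4 {j | hash k j = ℓ} Y (cond Q (seed ⁻¹' {k}))
  indep_buckets : ∀ k,
    iIndepFun (fun (ℓ : Fin t) ω (j : {j : Fin n // hash k j = ℓ}) => Y j ω)
      (cond Q (seed ⁻¹' {k}))

/-! The proof is a Lindeberg replacement, run bucket by bucket, with logistic smoothing.

Smoothing. The indicator of a set of sign vectors is replaced by `logisticSum S (x / lam)`, the
probability that independent random signs with logistic parameters `x i / lam` fall in `S`. The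
derivatives of the weight of a sign vector are that weight times polynomials in bounded logarithmic
derivatives. Since the weights sum to one, the third-order Taylor remainder is at most `5 * (∑ |w
e|) ^ 3`, uniformly over all sets `S` (`exists_logisticSum_taylor`), so no factor `2 ^ d` appears.

Replacement. For a fixed hash function the bucket sums are independent, and each has the same first
two moments as its Gaussian counterpart. Exchanging them one at a time costs only third moments. By
4-wise independence and hypercontractivity the fourth moment of a bucket sum is `O(η⁻⁴ s²)`, where
`s` is the variance of the bucket, so by Lyapunov its third moment is `O(η⁻² s^(3/2))`.

Boundary. Smoothing errs by at most twice the sum over coordinates of the logistic density at `(x i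
- Θ i) / lam`. Under the Gaussian each coordinate is standard, so each term is `O(lam)`. The density
is itself a two-sign `logisticSum`, so the same replacement bound transfers this estimate to the
hashed sum (`IsBucketFamily.abs_real_sub_le`).

Balance. One splits `2 s^(3/2) ≤ α s + α⁻¹ s²` with the same `α` for every seed. The variances `s`
add up to `d`, and collision preservation bounds the average of `∑ s²` by `2 (d²/t + ∑ σ⁴)`. The
choice in `exists_scale` equalises all error terms. The identity hash treats the original sum, and a
triangle inequality through the Gaussian compares the two sums. -/

/-! ### Logistic signs and a Taylor estimate in one variable -/

/-- The real number `1` or `-1` encoded by a Boolean. -/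
noncomputable def boolSign (s : Bool) : ℝ := bif s then 1 else -1

lemma boolSign_not (s : Bool) : boolSign (!s) = -boolSign s := by
  cases s <;> simp [boolSign]

lemma boolSign_mul_self (s : Bool) : boolSign s * boolSign s = 1 := by
  cases s <;> simp [boolSign]

lemma abs_boolSign (s : Bool) : |boolSign s| = 1 := by
  cases s <;> simp [boolSign]

/-- The probability that a logistic random sign with parameter `u` equals `s`. -/
noncomputable def logisticProb (s : Bool) (u : ℝ) : ℝ := Real.sigmoid (boolSign s * u)

lemma logisticProb_pos (s : Bool) (u : ℝ) : 0 < logisticProb s u := Real.sigmoid_pos _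

lemma logisticProb_nonneg (s : Bool) (u : ℝ) : 0 ≤ logisticProb s u := (logisticProb_pos s u).le

lemma logisticProb_le_one (s : Bool) (u : ℝ) : logisticProb s u ≤ 1 := Real.sigmoid_le_one _

lemma logisticProb_not (s : Bool) (u : ℝ) : logisticProb (!s) u = 1 - logisticProb s u := by
  rw [logisticProb, logisticProb, boolSign_not, neg_mul, Real.sigmoid_neg]

lemma continuous_logisticProb (s : Bool) : Continuous (logisticProb s) := by
  unfold logisticProb
  exact continuous_sigmoid.comp (by fun_prop)

lemma logisticProb_mul_not (s : Bool) (u : ℝ) :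
    logisticProb s u * logisticProb (!s) u = logisticProb true u * logisticProb false u := by
  cases s
  · exact mul_comm _ _
  · rfl

lemma hasDerivAt_logisticProb (s : Bool) (y w τ : ℝ) :
    HasDerivAt (fun τ => logisticProb s (y + τ * w))
      (w * boolSign s * (logisticProb true (y + τ * w) * logisticProb false (y + τ * w))) τ := by
  have h1 : HasDerivAt (fun τ : ℝ => boolSign s * (y + τ * w)) (boolSign s * w) τ := by
    simpa using (((hasDerivAt_id τ).mul_const w).const_add y).const_mul (boolSign s)
  have h2 := (Real.hasDerivAt_sigmoid (boolSign s * (y + τ * w))).comp τ h1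
  refine h2.congr_deriv ?_
  rw [← logisticProb_mul_not s, logisticProb_not, logisticProb]
  ring

/-- Second-order Taylor estimate on the unit interval. -/
lemma abs_taylor_two_le {g g1 g2 g3 : ℝ → ℝ} {M : ℝ}
    (h1 : ∀ τ, HasDerivAt g (g1 τ) τ) (h2 : ∀ τ, HasDerivAt g1 (g2 τ) τ)
    (h3 : ∀ τ, HasDerivAt g2 (g3 τ) τ) (hM : ∀ τ, |g3 τ| ≤ M) :
    |g 1 - g 0 - g1 0 - g2 0 / 2| ≤ M := by
  have M0 : 0 ≤ M := (abs_nonneg _).trans (hM 0)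
  -- Applied three times, to the Taylor remainders of `g2`, `g1` and `g`: each vanishes at 0 and has
  -- the previous one as derivative. The factor 1/6 is given away.
  have key : ∀ {f f' : ℝ → ℝ}, f 0 = 0 → (∀ τ, HasDerivAt f (f' τ) τ) →
      (∀ τ ∈ Set.Icc (0 : ℝ) 1, |f' τ| ≤ M) → ∀ τ ∈ Set.Icc (0 : ℝ) 1, |f τ| ≤ M := by
    intro f f' f0 hf hb τ hτ
    have := norm_image_sub_le_of_norm_deriv_le_segment' (f := f) (a := 0) (b := 1)
      (fun x _ => (hf x).hasDerivWithinAt) (fun x hx => hb x ⟨hx.1, hx.2.le⟩) τ hτ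
    rw [f0, sub_zero, sub_zero] at this
    exact this.trans (mul_le_of_le_one_right M0 hτ.2)
  have e2 := key (f := fun τ => g2 τ - g2 0) (by simp) (fun τ => (h3 τ).sub_const _)
    fun τ _ => hM τ
  have e1 := key (f := fun τ => g1 τ - g1 0 - τ * g2 0) (by simp)
    (fun τ => (((h2 τ).sub_const _).sub ((hasDerivAt_id τ).mul_const _)).congr_deriv
      (by rw [one_mul])) e2
  have e0 := key (f := fun τ => g τ - g 0 - τ * g1 0 - τ ^ 2 * (g2 0 / 2)) (by simp)
    (fun τ => ((((h1 τ).sub_const _).sub ((hasDerivAt_id τ).mul_const _)).sub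
      ((hasDerivAt_pow 2 τ).mul_const _)).congr_deriv
      (by simp only [Nat.cast_ofNat]; ring)) e1
  simpa using e0 1 (by simp)

/-! ### Smoothed indicators of sets of sign vectors -/

section LogisticSum

variable {E : Type*} [Fintype E]

/-- The probability that a vector of independent logistic signs with parameters `y e` lies in
`S`. -/
noncomputable def logisticSum (S : Finset (E → Bool)) (y : E → ℝ) : ℝ :=
  ∑ s ∈ S, ∏ e, logisticProb (s e) (y e)

lemma sum_prod_logisticProb [DecidableEq E] (y : E → ℝ) :
    ∑ s : E → Bool, ∏ e, logisticProb (s e) (y e) = 1 := by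
  have := Finset.prod_univ_sum (fun _ : E => (Finset.univ : Finset Bool))
    (fun e b => logisticProb b (y e))
  rw [Fintype.piFinset_univ] at this
  rw [← this]
  refine Finset.prod_eq_one fun e _ => ?_
  have := logisticProb_not true (y e)
  simp only [Bool.not_true] at this
  rw [Fintype.sum_bool, this]
  ring

lemma prod_logisticProb_nonneg (s : E → Bool) (y : E → ℝ) :
    0 ≤ ∏ e, logisticProb (s e) (y e) :=
  Finset.prod_nonneg fun _ _ => logisticProb_nonneg _ _

lemma logisticSum_nonneg (S : Finset (E → Bool)) (y : E → ℝ) : 0 ≤ logisticSum S y :=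
  Finset.sum_nonneg fun _ _ => prod_logisticProb_nonneg _ _

lemma logisticSum_le_one (S : Finset (E → Bool)) (y : E → ℝ) : logisticSum S y ≤ 1 := by
  classical
  rw [← sum_prod_logisticProb y]
  exact Finset.sum_le_sum_of_subset_of_nonneg (Finset.subset_univ _)
    fun _ _ _ => prod_logisticProb_nonneg _ _

lemma abs_logisticSum_le_one (S : Finset (E → Bool)) (y : E → ℝ) : |logisticSum S y| ≤ 1 :=
  abs_le.2 ⟨by linarith [logisticSum_nonneg S y], logisticSum_le_one S y⟩

lemma continuous_logisticSum (S : Finset (E → Bool)) : Continuous (logisticSum S) :=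
  continuous_finsetSum _ fun s _ => continuous_finsetProd _ fun e _ =>
    (continuous_logisticProb (s e)).comp (continuous_apply e)

lemma sum_abs_pow_le (w : E → ℝ) {m : ℕ} (hm : m ≠ 0) :
    ∑ e, |w e| ^ m ≤ (∑ e, |w e|) ^ m := by
  obtain ⟨k, rfl⟩ := Nat.exists_eq_succ_of_ne_zero hm
  rw [pow_succ', Finset.sum_mul]
  refine Finset.sum_le_sum fun e _ => ?_
  rw [pow_succ']
  exact mul_le_mul_of_nonneg_left (pow_le_pow_left₀ (abs_nonneg _)
    (Finset.single_le_sum (fun e _ => abs_nonneg (w e)) (Finset.mem_univ e)) k) (abs_nonneg _)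

/-- Third-order Taylor estimate for `logisticSum`. -/
lemma exists_logisticSum_taylor (S : Finset (E → Bool)) (y : E → ℝ) :
    ∃ (L : E → ℝ) (B : E → E → ℝ), ∀ w : E → ℝ,
      |logisticSum S (fun e => y e + w e) - logisticSum S y - ∑ e, L e * w e
        - ∑ e, ∑ f, B e f * (w e * w f)| ≤ 5 * (∑ e, |w e|) ^ 3 := by
  classical
  let κ : ℝ → ℝ := fun u => logisticProb true u * logisticProb false u
  -- `A s e` is the partial derivative of `log (p s)` in coordinate `e`, and `-κ (y e)` is the
  -- derivative of `A s e` in the same coordinate. Hence `L` is the gradient and `B` half the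
  -- Hessian; neither depends on `w`.
  let A : (E → Bool) → E → ℝ := fun s e => boolSign (s e) * logisticProb (!(s e)) (y e)
  let p : (E → Bool) → ℝ := fun s => ∏ e, logisticProb (s e) (y e)
  refine ⟨fun e => ∑ s ∈ S, p s * A s e,
    fun e f => (∑ s ∈ S, p s * (A s e * A s f - if e = f then κ (y e) else 0)) / 2, fun w => ?_⟩
  set N := ∑ e, |w e| with hN
  have N0 : 0 ≤ N := Finset.sum_nonneg fun _ _ => abs_nonneg _
  let P : (E → Bool) → ℝ → ℝ := fun s τ => ∏ e, logisticProb (s e) (y e + τ * w e)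
  -- Along the segment `P' = P * a`, `a' = b` and `b' = c`. The sign enters the derivative of `a`
  -- squared, so `b` and `c` no longer depend on `s`.
  let a : (E → Bool) → ℝ → ℝ := fun s τ =>
    ∑ e, w e * boolSign (s e) * logisticProb (!(s e)) (y e + τ * w e)
  let b : ℝ → ℝ := fun τ => ∑ e, -(w e) ^ 2 * κ (y e + τ * w e)
  let c : ℝ → ℝ := fun τ => ∑ e, -(w e) ^ 3 * (κ (y e + τ * w e) *
    (logisticProb false (y e + τ * w e) - logisticProb true (y e + τ * w e)))
  have κ0 : ∀ u, 0 ≤ κ u := fun u => mul_nonneg (logisticProb_nonneg _ _) (logisticProb_nonneg _ _)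
  have κ1 : ∀ u, κ u ≤ 1 := fun u =>
    mul_le_one₀ (logisticProb_le_one _ _) (logisticProb_nonneg _ _) (logisticProb_le_one _ _)
  have hP : ∀ s τ, HasDerivAt (P s) (P s τ * a s τ) τ := by
    intro s τ
    refine (HasDerivAt.fun_finsetProd fun e _ =>
      hasDerivAt_logisticProb (s e) (y e) (w e) τ).congr_deriv ?_
    rw [Finset.mul_sum]
    refine Finset.sum_congr rfl fun e _ => ?_
    rw [smul_eq_mul, ← logisticProb_mul_not (s e)]
    simp only [P]
    rw [← Finset.mul_prod_erase _ _ (Finset.mem_univ e)]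
    ring
  have ha : ∀ s τ, HasDerivAt (a s) (b τ) τ := by
    intro s τ
    refine (HasDerivAt.fun_sum fun e _ =>
      (hasDerivAt_logisticProb (!(s e)) (y e) (w e) τ).const_mul _).congr_deriv ?_
    refine Finset.sum_congr rfl fun e _ => ?_
    rw [boolSign_not]
    linear_combination (-(w e) ^ 2 * κ (y e + τ * w e)) * boolSign_mul_self (s e)
  have hb : ∀ τ, HasDerivAt b (c τ) τ := by
    intro τ
    refine (HasDerivAt.fun_sum fun e _ => ((hasDerivAt_logisticProb true (y e) (w e) τ).mul
      (hasDerivAt_logisticProb false (y e) (w e) τ)).const_mul _).congr_deriv ?_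
    refine Finset.sum_congr rfl fun e _ => ?_
    simp only [boolSign, cond_true, cond_false, κ]
    ring
  have aN : ∀ s τ, |a s τ| ≤ N := by
    intro s τ
    refine (Finset.abs_sum_le_sum_abs _ _).trans (Finset.sum_le_sum fun e _ => ?_)
    rw [abs_mul, abs_mul, abs_boolSign, mul_one, abs_of_nonneg (logisticProb_nonneg _ _)]
    exact mul_le_of_le_one_right (abs_nonneg _) (logisticProb_le_one _ _)
  have bN : ∀ τ, |b τ| ≤ N ^ 2 := by
    intro τ
    refine ((Finset.abs_sum_le_sum_abs _ _).trans (Finset.sum_le_sum fun e _ => ?_)).trans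
      (sum_abs_pow_le w two_ne_zero)
    rw [abs_mul, abs_neg, abs_pow, abs_of_nonneg (κ0 _)]
    exact mul_le_of_le_one_right (by positivity) (κ1 _)
  have cN : ∀ τ, |c τ| ≤ N ^ 3 := by
    intro τ
    refine ((Finset.abs_sum_le_sum_abs _ _).trans (Finset.sum_le_sum fun e _ => ?_)).trans
      (sum_abs_pow_le w three_ne_zero)
    rw [abs_mul, abs_neg, abs_pow, abs_mul, abs_of_nonneg (κ0 _)]
    refine mul_le_of_le_one_right (by positivity) (mul_le_one₀ (κ1 _) (abs_nonneg _) ?_)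
    rw [abs_le]
    constructor <;> linarith [logisticProb_nonneg true (y e + τ * w e),
      logisticProb_le_one true (y e + τ * w e), logisticProb_nonneg false (y e + τ * w e),
      logisticProb_le_one false (y e + τ * w e)]
  have h1 : ∀ τ, HasDerivAt (fun τ => ∑ s ∈ S, P s τ) (∑ s ∈ S, P s τ * a s τ) τ :=
    fun τ => HasDerivAt.fun_sum fun s _ => hP s τ
  have h2 : ∀ τ, HasDerivAt (fun τ => ∑ s ∈ S, P s τ * a s τ)
      (∑ s ∈ S, P s τ * (a s τ ^ 2 + b τ)) τ :=
    fun τ => HasDerivAt.fun_sum fun s _ => ((hP s τ).mul (ha s τ)).congr_deriv (by ring)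
  have h3 : ∀ τ, HasDerivAt (fun τ => ∑ s ∈ S, P s τ * (a s τ ^ 2 + b τ))
      (∑ s ∈ S, P s τ * (a s τ ^ 3 + 3 * a s τ * b τ + c τ)) τ :=
    fun τ => HasDerivAt.fun_sum fun s _ =>
      ((hP s τ).mul (((ha s τ).pow 2).add (hb τ))).congr_deriv
        (by simp only [Pi.add_apply, Pi.pow_apply, Nat.cast_ofNat]; ring)
  -- The constant is 5 = 1 + 3 + 1, one term for each of `a ^ 3`, `3 * a * b` and `c`; the weights
  -- `P s τ` sum to at most one.
  have hM : ∀ τ, |∑ s ∈ S, P s τ * (a s τ ^ 3 + 3 * a s τ * b τ + c τ)| ≤ 5 * N ^ 3 := by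
    intro τ
    calc |∑ s ∈ S, P s τ * (a s τ ^ 3 + 3 * a s τ * b τ + c τ)|
        ≤ ∑ s ∈ S, P s τ * (5 * N ^ 3) := by
          refine (Finset.abs_sum_le_sum_abs _ _).trans (Finset.sum_le_sum fun s _ => ?_)
          rw [abs_mul, abs_of_nonneg (prod_logisticProb_nonneg _ _)]
          refine mul_le_mul_of_nonneg_left ?_ (prod_logisticProb_nonneg _ _)
          have e1 : |a s τ ^ 3| ≤ N ^ 3 := by
            rw [abs_pow]; exact pow_le_pow_left₀ (abs_nonneg _) (aN s τ) 3
          have e2 : |3 * a s τ * b τ| ≤ 3 * N ^ 3 := by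
            rw [abs_mul, abs_mul, abs_of_pos (by norm_num : (0 : ℝ) < 3)]
            calc 3 * |a s τ| * |b τ| ≤ 3 * N * N ^ 2 := by
                  gcongr
                  · exact aN s τ
                  · exact bN τ
              _ = 3 * N ^ 3 := by ring
          linarith [abs_add_le (a s τ ^ 3 + 3 * a s τ * b τ) (c τ),
            abs_add_le (a s τ ^ 3) (3 * a s τ * b τ), cN τ]
      _ = logisticSum S (fun e => y e + τ * w e) * (5 * N ^ 3) := by
          rw [← Finset.sum_mul]; rfl
      _ ≤ 5 * N ^ 3 := mul_le_of_le_one_left (by positivity) (logisticSum_le_one _ _)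
  have main := abs_taylor_two_le h1 h2 h3 hM
  have pP : ∀ s, P s 0 = p s := fun s => by simp [P, p]
  have aA : ∀ s, a s 0 = ∑ e, A s e * w e := fun s => by
    simp only [a, A, zero_mul, add_zero]
    exact Finset.sum_congr rfl fun e _ => by ring
  have b0 : b 0 = -∑ e, κ (y e) * w e ^ 2 := by
    simp only [b, zero_mul, add_zero, ← Finset.sum_neg_distrib]
    exact Finset.sum_congr rfl fun e _ => by ring
  have lin : ∑ s ∈ S, P s 0 * a s 0 = ∑ e, (∑ s ∈ S, p s * A s e) * w e := by
    simp_rw [pP, aA, Finset.mul_sum, Finset.sum_mul]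
    rw [Finset.sum_comm]
    exact Finset.sum_congr rfl fun e _ => Finset.sum_congr rfl fun s _ => by ring
  have quad : (∑ s ∈ S, P s 0 * (a s 0 ^ 2 + b 0)) / 2 = ∑ e, ∑ f,
      ((∑ s ∈ S, p s * (A s e * A s f - if e = f then κ (y e) else 0)) / 2) * (w e * w f) := by
    have hs : ∀ s, P s 0 * (a s 0 ^ 2 + b 0) = ∑ e, ∑ f,
        p s * (A s e * A s f - if e = f then κ (y e) else 0) * (w e * w f) := by
      intro s
      rw [pP, aA, b0, sq, Finset.sum_mul_sum]
      simp only [mul_sub, sub_mul, Finset.sum_sub_distrib, mul_ite, ite_mul, mul_zero, zero_mul,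
        Finset.sum_ite_eq, Finset.mem_univ, if_true, mul_add, mul_neg, Finset.mul_sum]
      rw [sub_eq_add_neg]
      congr 1
      · exact Finset.sum_congr rfl fun e _ => Finset.sum_congr rfl fun f _ => by ring
      · congr 1
        exact Finset.sum_congr rfl fun e _ => by ring
    simp_rw [hs, div_mul_eq_mul_div, ← Finset.sum_div, Finset.sum_mul]
    congr 1
    rw [Finset.sum_comm]
    exact Finset.sum_congr rfl fun e _ => Finset.sum_comm
  rw [lin, quad] at main
  simpa [P, logisticSum] using main

lemma one_sub_sum_le_prod_one_sub {ι : Type*} (s : Finset ι) {f : ι → ℝ}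
    (h0 : ∀ i, 0 ≤ f i) (h1 : ∀ i, f i ≤ 1) : 1 - ∑ i ∈ s, f i ≤ ∏ i ∈ s, (1 - f i) := by
  classical
  induction s using Finset.induction_on with
  | empty => simp
  | insert i s hi ih =>
    rw [Finset.sum_insert hi, Finset.prod_insert hi]
    have := Finset.sum_nonneg fun j (_ : j ∈ s) => h0 j
    nlinarith [h0 i, h1 i, mul_le_mul_of_nonneg_left ih (sub_nonneg.2 (h1 i)),
      mul_nonneg (h0 i) this]

/-- A sign vector `s` is sampled with probability close to one unless some coordinate has a
parameter that is close to zero. -/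
lemma one_sub_prod_logisticProb_le (s : E → Bool) (y : E → ℝ)
    (hs : ∀ e, 0 ≤ boolSign (s e) * y e) :
    1 - ∏ e, logisticProb (s e) (y e) ≤
      2 * ∑ e, logisticProb true (y e) * logisticProb false (y e) := by
  have h1 : 1 - ∑ e, (1 - logisticProb (s e) (y e)) ≤ ∏ e, logisticProb (s e) (y e) := by
    have := one_sub_sum_le_prod_one_sub Finset.univ
      (f := fun e => 1 - logisticProb (s e) (y e))
      (fun e => by linarith [logisticProb_le_one (s e) (y e)])
      (fun e => by linarith [logisticProb_nonneg (s e) (y e)])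
    simpa using this
  have h2 : ∑ e, (1 - logisticProb (s e) (y e)) ≤
      2 * ∑ e, logisticProb true (y e) * logisticProb false (y e) := by
    rw [Finset.mul_sum]
    refine Finset.sum_le_sum fun e _ => ?_
    rw [← logisticProb_mul_not (s e), logisticProb_not]
    -- A sign agreeing with its parameter has probability `p ≥ 1/2`, whence `1 - p ≤ 2 * p * (1 -
    -- p)`.
    have : 1 / 2 ≤ logisticProb (s e) (y e) := by
      have := Real.sigmoid_le (hs e)
      rw [Real.sigmoid_zero] at this
      simpa [logisticProb] using this
    nlinarith [logisticProb_le_one (s e) (y e)]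
  linarith

/-- The weight of `s` itself is close to one. It is part of the sum when `s ∈ S`; otherwise it is
disjoint from the sum, and the total weight of `insert s S` is at most one. -/
lemma abs_ite_sub_logisticSum_le (S : Finset (E → Bool)) (s : E → Bool) [Decidable (s ∈ S)]
    (y : E → ℝ) (hs : ∀ e, 0 ≤ boolSign (s e) * y e) :
    |(if s ∈ S then 1 else 0) - logisticSum S y| ≤
      2 * ∑ e, logisticProb true (y e) * logisticProb false (y e) := by
  classical
  have h := one_sub_prod_logisticProb_le s y hs
  have h1 := logisticSum_le_one S y
  have h0 := logisticSum_nonneg S y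
  split_ifs with hS
  · have : ∏ e, logisticProb (s e) (y e) ≤ logisticSum S y :=
      Finset.single_le_sum (f := fun s => ∏ e, logisticProb (s e) (y e))
        (fun s _ => prod_logisticProb_nonneg s y) hS
    rw [abs_of_nonneg (by linarith)]
    linarith
  · have : logisticSum S y + ∏ e, logisticProb (s e) (y e) ≤ 1 := by
      have := logisticSum_le_one (insert s S) y
      rwa [logisticSum, Finset.sum_insert hS, add_comm] at this
    rw [zero_sub, abs_neg, abs_of_nonneg h0]
    linarith

end LogisticSum

/-! ### Moments of sums under limited independence -/

section Moments

variable {Ω : Type*} [MeasurableSpace Ω] {P : Measure Ω}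

/-- Two rounds of the arithmetic-geometric mean inequality dominate the product by the sum of the
fourth powers. Taking some factors constant gives the shorter products below. -/
lemma integrable_mul_four {a b c d : Ω → ℝ} (ha : MemLp a 4 P) (hb : MemLp b 4 P)
    (hc : MemLp c 4 P) (hd : MemLp d 4 P) :
    Integrable (fun ω => a ω * b ω * c ω * d ω) P := by
  have key : ∀ {f : Ω → ℝ}, MemLp f 4 P → Integrable (fun ω => ‖f ω‖ ^ 4) P := fun hf => by
    simpa using hf.integrable_norm_pow (p := 4) (by norm_num)
  refine (((key ha).add (key hb)).add ((key hc).add (key hd))).mono'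
    (((ha.1.mul hb.1).mul hc.1).mul hd.1) (ae_of_all _ fun ω => ?_)
  simp only [norm_mul, Pi.add_apply]
  have h1 := two_mul_le_add_sq (‖a ω‖ * ‖b ω‖) (‖c ω‖ * ‖d ω‖)
  have h2 := two_mul_le_add_sq (‖a ω‖ ^ 2) (‖b ω‖ ^ 2)
  have h3 := two_mul_le_add_sq (‖c ω‖ ^ 2) (‖d ω‖ ^ 2)
  have h4 : 0 ≤ ‖a ω‖ ^ 4 + ‖b ω‖ ^ 4 + ‖c ω‖ ^ 4 + ‖d ω‖ ^ 4 := by positivity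
  nlinarith

lemma integrable_mul_three [IsFiniteMeasure P] {a b c : Ω → ℝ} (ha : MemLp a 4 P)
    (hb : MemLp b 4 P) (hc : MemLp c 4 P) : Integrable (fun ω => a ω * b ω * c ω) P := by
  simpa using integrable_mul_four ha hb hc (memLp_const (1 : ℝ))

lemma integrable_mul_two [IsFiniteMeasure P] {a b : Ω → ℝ} (ha : MemLp a 4 P)
    (hb : MemLp b 4 P) : Integrable (fun ω => a ω * b ω) P := by
  simpa using integrable_mul_three ha hb (memLp_const (1 : ℝ))

lemma integrable_of_memLp_four [IsFiniteMeasure P] {a : Ω → ℝ} (ha : MemLp a 4 P) :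
    Integrable a P := by
  simpa using integrable_mul_two ha (memLp_const (1 : ℝ))

/-- Lyapunov's inequality between the second, third and fourth moments. -/
lemma integral_abs_pow_three_le [IsFiniteMeasure P] {a : Ω → ℝ} (ha : MemLp a 4 P) :
    ∫ ω, |a ω| ^ 3 ∂P ≤ √(∫ ω, a ω ^ 2 ∂P) * √(∫ ω, a ω ^ 4 ∂P) := by
  have h2 : MemLp (fun ω => |a ω|) (ENNReal.ofReal 2) P := by
    rw [ENNReal.ofReal_ofNat]
    exact (ha.mono_exponent (by norm_num)).abs
  have h4 : MemLp (fun ω => a ω ^ 2) (ENNReal.ofReal 2) P := by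
    rw [ENNReal.ofReal_ofNat]
    refine (memLp_two_iff_integrable_sq (ha.1.pow 2)).2 ?_
    refine (integrable_mul_four ha ha ha ha).congr (ae_of_all _ fun ω => ?_)
    simp only [Pi.pow_apply]
    ring
  have := integral_mul_le_Lp_mul_Lq_of_nonneg (μ := P) (p := 2) (q := 2)
    (f := fun ω => |a ω|) (g := fun ω => a ω ^ 2) ⟨by norm_num, by norm_num, by norm_num⟩
    (ae_of_all _ fun _ => abs_nonneg _) (ae_of_all _ fun _ => sq_nonneg _) h2 h4
  have e3 : ∀ ω, |a ω| * a ω ^ 2 = |a ω| ^ 3 := fun ω => by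
    rw [← sq_abs (a ω)]
    ring
  have e4 : ∀ ω, (a ω ^ 2) ^ (2 : ℝ) = a ω ^ 4 := fun ω => by
    rw [Real.rpow_two]
    ring
  simp_rw [e3, e4, Real.rpow_two, sq_abs] at this
  rwa [Real.sqrt_eq_rpow, Real.sqrt_eq_rpow]

lemma WiseIndepOn.comp {ι E F : Type*} [MeasurableSpace E] [MeasurableSpace F] {r : ℕ}
    {B : Set ι} {Y : ι → Ω → E} (h : WiseIndepOn r B Y P) {g : E → F} (hg : Measurable g) :
    WiseIndepOn r B (fun j ω => g (Y j ω)) P := fun J hJ hr =>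
  (h J hJ hr).comp (fun _ => g) fun _ => hg

/-- The indices `a`, `b`, `c` may coincide, so the four indices form a set of at most four elements.
This covers every mixed term in the expansion of a fourth power in which `j` is singled out. -/
lemma WiseIndepOn.indepFun_triple {ι E : Type*} [MeasurableSpace E] {B : Set ι} {Y : ι → Ω → E}
    (h : WiseIndepOn 4 B Y P) (hm : ∀ j, Measurable (Y j)) {a b c j : ι} (ha : a ∈ B)
    (hb : b ∈ B) (hc : c ∈ B) (hj : j ∈ B) (haj : a ≠ j) (hbj : b ≠ j) (hcj : c ≠ j) :
    IndepFun (fun ω => (Y a ω, Y b ω, Y c ω)) (Y j) P := by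
  classical
  let J : Finset ι := {a, b, c, j}
  have hJ : (J : Set ι) ⊆ B := by
    intro i hi
    simp only [J, Finset.coe_insert, Finset.coe_singleton, Set.mem_insert_iff,
      Set.mem_singleton_iff] at hi
    rcases hi with rfl | rfl | rfl | rfl <;> assumption
  have hI := h J hJ Finset.card_le_four
  let a' : J := ⟨a, by simp [J]⟩
  let b' : J := ⟨b, by simp [J]⟩
  let c' : J := ⟨c, by simp [J]⟩
  let j' : J := ⟨j, by simp [J]⟩
  let S : Finset J := {a', b', c'}
  have hd : Disjoint S {j'} := by
    simp [S, a', b', c', j', haj.symm, hbj.symm, hcj.symm]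
  have := hI.indepFun_finset S {j'} hd fun i => hm i
  exact this.comp (φ := fun f : S → E => (f ⟨a', by simp [S]⟩, f ⟨b', by simp [S]⟩,
      f ⟨c', by simp [S]⟩))
    (ψ := fun f : ({j'} : Finset J) → E => f ⟨j', by simp⟩) (by fun_prop) (by fun_prop)

lemma WiseIndepOn.indepFun_pair {ι E : Type*} [MeasurableSpace E] {B : Set ι} {Y : ι → Ω → E}
    (h : WiseIndepOn 4 B Y P) (hm : ∀ j, Measurable (Y j)) {a j : ι} (ha : a ∈ B)
    (hj : j ∈ B) (haj : a ≠ j) : IndepFun (Y a) (Y j) P :=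
  (h.indepFun_triple hm ha ha ha hj haj haj haj).comp measurable_fst measurable_id

/-- Mixed second moment of sums of pairwise independent centred variables. -/
lemma integral_sum_mul_sum [IsFiniteMeasure P] {ι : Type*} (s : Finset ι) {y z : ι → Ω → ℝ}
    (hy : ∀ j, MemLp (y j) 4 P) (hz : ∀ j, MemLp (z j) 4 P)
    (hy0 : ∀ j, ∫ ω, y j ω ∂P = 0)
    (hi : ∀ a ∈ s, ∀ b ∈ s, a ≠ b → IndepFun (y a) (z b) P) :
    ∫ ω, (∑ j ∈ s, y j ω) * ∑ j ∈ s, z j ω ∂P = ∑ j ∈ s, ∫ ω, y j ω * z j ω ∂P := by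
  classical
  simp_rw [Finset.sum_mul_sum]
  rw [integral_finsetSum _ fun a _ => integrable_finsetSum _ fun b _ =>
    integrable_mul_two (hy a) (hz b)]
  refine Finset.sum_congr rfl fun a ha => ?_
  rw [integral_finsetSum _ fun b _ => integrable_mul_two (hy a) (hz b)]
  refine Finset.sum_eq_single_of_mem a ha fun b hb hab => ?_
  rw [(hi a ha b hb hab.symm).integral_fun_mul_eq_mul_integral (hy a).1 (hz b).1, hy0, zero_mul]

/-- Fourth moment of a sum of 4-wise independent centred variables. -/
lemma integral_sum_pow_four_le [IsProbabilityMeasure P] {ι : Type*} {B : Set ι} {y : ι → Ω → ℝ}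
    (h : WiseIndepOn 4 B y P) (hm : ∀ j, Measurable (y j)) (hy : ∀ j, MemLp (y j) 4 P)
    (hy0 : ∀ j, ∫ ω, y j ω ∂P = 0) (s : Finset ι) (hs : (s : Set ι) ⊆ B) :
    ∫ ω, (∑ j ∈ s, y j ω) ^ 4 ∂P ≤
      ∑ j ∈ s, ∫ ω, y j ω ^ 4 ∂P + 3 * (∑ j ∈ s, ∫ ω, y j ω ^ 2 ∂P) ^ 2 := by
  classical
  induction s using Finset.induction_on with
  | empty => simp
  | insert j s hj ih =>
    rw [Finset.coe_insert, Set.insert_subset_iff] at hs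
    have ne : ∀ a ∈ s, a ≠ j := fun a ha e => hj (e ▸ ha)
    have sB : ∀ a ∈ s, a ∈ B := fun a ha => hs.2 ha
    have ih := ih hs.2
    let S : Ω → ℝ := fun ω => ∑ j ∈ s, y j ω
    have hS : MemLp S 4 P := memLp_finsetSum _ fun j _ => hy j
    have hj4 := hy j
    -- Each product of three earlier summands is independent of the centred `y j`. In `e13` the
    -- centred factor is the earlier summand instead.
    have e31 : ∫ ω, S ω * S ω * S ω * y j ω ∂P = 0 := by
      simp only [S, Finset.sum_mul, Finset.mul_sum]
      rw [integral_finsetSum _ fun a _ => integrable_finsetSum _ fun b _ =>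
        integrable_finsetSum _ fun c _ => integrable_mul_four (hy _) (hy _) (hy _) hj4]
      refine Finset.sum_eq_zero fun a ha => ?_
      rw [integral_finsetSum _ fun b _ =>
        integrable_finsetSum _ fun c _ => integrable_mul_four (hy _) (hy _) (hy _) hj4]
      refine Finset.sum_eq_zero fun b hb => ?_
      rw [integral_finsetSum _ fun c _ => integrable_mul_four (hy _) (hy _) (hy _) hj4]
      refine Finset.sum_eq_zero fun c hc => ?_
      have hi := (h.indepFun_triple hm (sB c hc) (sB b hb) (sB a ha) hs.1 (ne c hc) (ne b hb)
        (ne a ha)).comp (φ := fun p : ℝ × ℝ × ℝ => p.1 * p.2.1 * p.2.2) (ψ := id)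
        (by fun_prop) measurable_id
      have := hi.integral_fun_mul_eq_mul_integral
        (((hm c).mul (hm b)).mul (hm a)).aestronglyMeasurable (hm j).aestronglyMeasurable
      simp only [Function.comp_apply, id, hy0, mul_zero] at this
      rw [← this]
    have e22 : ∫ ω, S ω * S ω * y j ω * y j ω ∂P =
        (∑ j ∈ s, ∫ ω, y j ω ^ 2 ∂P) * ∫ ω, y j ω ^ 2 ∂P := by
      have hSS : ∑ j ∈ s, ∫ ω, y j ω ^ 2 ∂P = ∫ ω, S ω * S ω ∂P := by
        rw [integral_sum_mul_sum s hy hy hy0 fun a ha b hb hab =>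
          h.indepFun_pair hm (sB a ha) (sB b hb) hab]
        simp_rw [sq]
      rw [hSS]
      simp only [S, Finset.sum_mul, Finset.mul_sum]
      rw [integral_finsetSum _ fun a _ => integrable_finsetSum _ fun b _ =>
          integrable_mul_four (hy _) (hy _) hj4 hj4,
        integral_finsetSum _ fun a _ => integrable_finsetSum _ fun b _ =>
          integrable_mul_two (hy _) (hy _), Finset.sum_mul]
      refine Finset.sum_congr rfl fun a ha => ?_
      rw [integral_finsetSum _ fun b _ => integrable_mul_four (hy _) (hy _) hj4 hj4,
        integral_finsetSum _ fun b _ => integrable_mul_two (hy _) (hy _), Finset.sum_mul]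
      refine Finset.sum_congr rfl fun b hb => ?_
      have hi := (h.indepFun_triple hm (sB b hb) (sB a ha) (sB a ha) hs.1 (ne b hb) (ne a ha)
        (ne a ha)).comp (φ := fun p : ℝ × ℝ × ℝ => p.1 * p.2.1) (ψ := fun u => u ^ 2)
        (by fun_prop) (by fun_prop)
      have := hi.integral_fun_mul_eq_mul_integral
        ((hm b).mul (hm a)).aestronglyMeasurable ((hm j).pow_const 2).aestronglyMeasurable
      simp only [Function.comp_apply] at this
      rw [← this]
      exact integral_congr_ae (ae_of_all _ fun ω => by ring)
    have e13 : ∫ ω, S ω * y j ω * y j ω * y j ω ∂P = 0 := by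
      simp only [S, Finset.sum_mul]
      rw [integral_finsetSum _ fun a _ => integrable_mul_four (hy _) hj4 hj4 hj4]
      refine Finset.sum_eq_zero fun a ha => ?_
      have hi := (h.indepFun_pair hm (sB a ha) hs.1 (ne a ha)).comp (φ := id)
        (ψ := fun u => u ^ 3) measurable_id (by fun_prop)
      have := hi.integral_fun_mul_eq_mul_integral
        (hm a).aestronglyMeasurable ((hm j).pow_const 3).aestronglyMeasurable
      simp only [Function.comp_apply, id, hy0, zero_mul] at this
      rw [← this]
      exact integral_congr_ae (ae_of_all _ fun ω => by ring)
    have i40 := integrable_mul_four hS hS hS hS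
    have i31 := (integrable_mul_four hS hS hS hj4).const_mul 4
    have i22 := (integrable_mul_four hS hS hj4 hj4).const_mul 6
    have i13 := (integrable_mul_four hS hj4 hj4 hj4).const_mul 4
    have i04 := integrable_mul_four hj4 hj4 hj4 hj4
    have expand : ∫ ω, (∑ i ∈ insert j s, y i ω) ^ 4 ∂P =
        ∫ ω, (∑ i ∈ s, y i ω) ^ 4 ∂P +
          6 * ((∑ j ∈ s, ∫ ω, y j ω ^ 2 ∂P) * ∫ ω, y j ω ^ 2 ∂P) + ∫ ω, y j ω ^ 4 ∂P := by
      have : ∀ ω, (∑ i ∈ insert j s, y i ω) ^ 4 =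
          S ω * S ω * S ω * S ω + 4 * (S ω * S ω * S ω * y j ω) +
          6 * (S ω * S ω * y j ω * y j ω) + 4 * (S ω * y j ω * y j ω * y j ω) +
          y j ω * y j ω * y j ω * y j ω := fun ω => by
        rw [Finset.sum_insert hj]
        simp only [S]
        ring
      simp_rw [this]
      have j1 : Integrable (fun ω => S ω * S ω * S ω * S ω + 4 * (S ω * S ω * S ω * y j ω)) P :=
        i40.add i31
      have j2 : Integrable (fun ω => S ω * S ω * S ω * S ω + 4 * (S ω * S ω * S ω * y j ω) +
          6 * (S ω * S ω * y j ω * y j ω)) P := j1.add i22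
      have j3 : Integrable (fun ω => S ω * S ω * S ω * S ω + 4 * (S ω * S ω * S ω * y j ω) +
          6 * (S ω * S ω * y j ω * y j ω) + 4 * (S ω * y j ω * y j ω * y j ω)) P := j2.add i13
      rw [integral_add j3 i04, integral_add j2 i13, integral_add j1 i22, integral_add i40 i31,
        integral_const_mul, integral_const_mul, integral_const_mul,
        e31, e22, e13, mul_zero, add_zero, add_zero]
      congr 2
      · exact integral_congr_ae (ae_of_all _ fun ω => by simp only [S]; ring)
      · exact funext fun ω => by ring
    -- The cross term of `3 * (A + B) ^ 2` is exactly the `6 * A * B` of the binomial expansion; the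
    -- leftover `3 * B ^ 2` is nonnegative.
    rw [expand, Finset.sum_insert hj, Finset.sum_insert hj]
    nlinarith [sq_nonneg (∫ ω, y j ω ^ 2 ∂P)]

end Moments

/-! ### Exchanging one small random shift -/

section Exchange

variable {E Ω Ω' : Type*} [Fintype E] [MeasurableSpace Ω] [MeasurableSpace Ω']

/-- Integrating the Taylor estimate at a deterministic base point leaves a main term that sees only
the first two moments of `V`; two shifts sharing these moments can then be compared. -/
lemma abs_integral_logisticSum_sub_taylor_le {P : Measure Ω} [IsProbabilityMeasure P]
    {V : Ω → E → ℝ} (hV : ∀ e, MemLp (fun ω => V ω e) 4 P) {β : ℝ}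
    (hβ : ∀ e, ∫ ω, |V ω e| ^ 3 ∂P ≤ β) {S : Finset (E → Bool)} {y L : E → ℝ} {B : E → E → ℝ}
    (hLB : ∀ w : E → ℝ, |logisticSum S (fun e => y e + w e) - logisticSum S y - ∑ e, L e * w e
        - ∑ e, ∑ f, B e f * (w e * w f)| ≤ 5 * (∑ e, |w e|) ^ 3) :
    |∫ ω, logisticSum S (fun e => y e + V ω e) ∂P - (logisticSum S y
      + ∑ e, L e * ∫ ω, V ω e ∂P + ∑ e, ∑ f, B e f * ∫ ω, V ω e * V ω f ∂P)|
      ≤ 5 * (Fintype.card E : ℝ) ^ 3 * β := by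
  have iF : Integrable (fun ω => logisticSum S (fun e => y e + V ω e)) P := by
    refine Integrable.of_bound (C := 1) ?_ (ae_of_all _ fun ω => abs_logisticSum_le_one _ _)
    exact (continuous_logisticSum S).comp_aestronglyMeasurable
      (aemeasurable_pi_lambda _ fun e => ((hV e).1.aemeasurable.const_add _)).aestronglyMeasurable
  have iL : Integrable (fun ω => ∑ e, L e * V ω e) P :=
    integrable_finsetSum _ fun e _ => (integrable_of_memLp_four (hV e)).const_mul _
  have iB : Integrable (fun ω => ∑ e, ∑ f, B e f * (V ω e * V ω f)) P :=
    integrable_finsetSum _ fun e _ => integrable_finsetSum _ fun f _ =>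
      (integrable_mul_two (hV e) (hV f)).const_mul _
  have i3 : ∀ e, Integrable (fun ω => |V ω e| ^ 3) P := fun e => by
    refine (integrable_mul_three (hV e) (hV e) (hV e)).abs.congr (ae_of_all _ fun ω => ?_)
    simp only [abs_mul]
    ring
  have iF0 : Integrable (fun ω => logisticSum S (fun e => y e + V ω e) - logisticSum S y) P :=
    iF.sub (integrable_const _)
  have iFL : Integrable (fun ω => logisticSum S (fun e => y e + V ω e) - logisticSum S y
      - ∑ e, L e * V ω e) P := iF0.sub iL
  have eL : ∫ ω, ∑ e, L e * V ω e ∂P = ∑ e, L e * ∫ ω, V ω e ∂P := by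
    rw [integral_finsetSum _ fun e _ => (integrable_of_memLp_four (hV e)).const_mul _]
    simp_rw [integral_const_mul]
  have eB : ∫ ω, ∑ e, ∑ f, B e f * (V ω e * V ω f) ∂P =
      ∑ e, ∑ f, B e f * ∫ ω, V ω e * V ω f ∂P := by
    rw [integral_finsetSum _ fun e _ => integrable_finsetSum _ fun f _ =>
      (integrable_mul_two (hV e) (hV f)).const_mul _]
    refine Finset.sum_congr rfl fun e _ => ?_
    rw [integral_finsetSum _ fun f _ => (integrable_mul_two (hV e) (hV f)).const_mul _]
    simp_rw [integral_const_mul]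
  have eq : ∫ ω, logisticSum S (fun e => y e + V ω e) ∂P - (logisticSum S y
      + ∑ e, L e * ∫ ω, V ω e ∂P + ∑ e, ∑ f, B e f * ∫ ω, V ω e * V ω f ∂P) =
      ∫ ω, (logisticSum S (fun e => y e + V ω e) - logisticSum S y - ∑ e, L e * V ω e
        - ∑ e, ∑ f, B e f * (V ω e * V ω f)) ∂P := by
    rw [integral_sub iFL iB, integral_sub iF0 iL, integral_sub iF (integrable_const _),
      eL, eB]
    simp only [integral_const, probReal_univ, one_smul]
    ring
  rw [eq]
  -- The power mean inequality reduces the remainder to coordinatewise third moments; summing these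
  -- supplies the third factor of the cardinality.
  have bound : ∀ w : E → ℝ, (∑ e, |w e|) ^ 3 ≤ (Fintype.card E : ℝ) ^ 2 * ∑ e, |w e| ^ 3 := by
    intro w
    rcases isEmpty_or_nonempty E with _ | _
    · simp
    have := pow_sum_div_card_le_sum_pow (s := Finset.univ) (f := fun e => |w e|)
      (fun e _ => abs_nonneg (w e)) 2
    rwa [div_le_iff₀' (by
      have := Fintype.card_pos (α := E)
      rw [Finset.card_univ]
      positivity), Finset.card_univ] at this
  calc _ ≤ ∫ ω, |logisticSum S (fun e => y e + V ω e) - logisticSum S y - ∑ e, L e * V ω e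
        - ∑ e, ∑ f, B e f * (V ω e * V ω f)| ∂P := abs_integral_le_integral_abs
    _ ≤ ∫ ω, 5 * ((Fintype.card E : ℝ) ^ 2 * ∑ e, |V ω e| ^ 3) ∂P := by
      refine integral_mono (iFL.sub iB).abs
        (((integrable_finsetSum _ fun e _ => i3 e).const_mul _).const_mul _) fun ω => ?_
      exact (hLB (V ω)).trans (mul_le_mul_of_nonneg_left (bound _) (by norm_num))
    _ = 5 * ((Fintype.card E : ℝ) ^ 2 * ∑ e, ∫ ω, |V ω e| ^ 3 ∂P) := by
      rw [integral_const_mul, integral_const_mul, integral_finsetSum _ fun e _ => i3 e]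
    _ ≤ 5 * ((Fintype.card E : ℝ) ^ 2 * ∑ e : E, β) := by
      gcongr with e
      exact hβ e
    _ = 5 * (Fintype.card E : ℝ) ^ 3 * β := by
      rw [Finset.sum_const, Finset.card_univ, nsmul_eq_mul]
      ring

/-- The expectation of `logisticSum` at a small random shift is determined by the first two
moments of the shift, up to third moments. -/
lemma abs_integral_logisticSum_sub_le {P : Measure Ω} [IsProbabilityMeasure P] {Q : Measure Ω'}
    [IsProbabilityMeasure Q] {V : Ω → E → ℝ} {W : Ω' → E → ℝ}
    (hV : ∀ e, MemLp (fun ω => V ω e) 4 P) (hW : ∀ e, MemLp (fun ω => W ω e) 4 Q)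
    (h1 : ∀ e, ∫ ω, V ω e ∂P = ∫ ω, W ω e ∂Q)
    (h2 : ∀ e f, ∫ ω, V ω e * V ω f ∂P = ∫ ω, W ω e * W ω f ∂Q)
    {β : ℝ} (hVβ : ∀ e, ∫ ω, |V ω e| ^ 3 ∂P ≤ β) (hWβ : ∀ e, ∫ ω, |W ω e| ^ 3 ∂Q ≤ β)
    (S : Finset (E → Bool)) (y : E → ℝ) :
    |∫ ω, logisticSum S (fun e => y e + V ω e) ∂P - ∫ ω, logisticSum S (fun e => y e + W ω e) ∂Q|
      ≤ 10 * (Fintype.card E : ℝ) ^ 3 * β := by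
  obtain ⟨L, B, hLB⟩ := exists_logisticSum_taylor S y
  have kV := abs_integral_logisticSum_sub_taylor_le hV hVβ hLB
  have kW := abs_integral_logisticSum_sub_taylor_le hW hWβ hLB
  simp_rw [h1, h2] at kV
  rw [abs_le] at kV kW ⊢
  constructor <;> linarith [kV.1, kV.2, kW.1, kW.2]

end Exchange

/-! ### The replacement method on two probability spaces -/

section Replacement

variable {E Ω Ω' : Type*} [MeasurableSpace Ω] [MeasurableSpace Ω']

lemma ProbabilityTheory.IndepFun.integral_add_eq {P : Measure Ω} [IsProbabilityMeasure P]
    {U V : Ω → E → ℝ} (hUV : IndepFun U V P) (hU : Measurable U) (hV : Measurable V)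
    {F : (E → ℝ) → ℝ} (hF : Measurable F) (hF1 : ∀ x, |F x| ≤ 1) (y : E → ℝ) :
    ∫ ω, F (y + (U ω + V ω)) ∂P = ∫ ω, ∫ ω', F (y + (U ω + V ω')) ∂P ∂P := by
  have hm : Measurable fun p : (E → ℝ) × (E → ℝ) => F (y + (p.1 + p.2)) := by fun_prop
  have e1 : ∫ ω, F (y + (U ω + V ω)) ∂P =
      ∫ p, F (y + (p.1 + p.2)) ∂(P.map fun ω => (U ω, V ω)) :=
    (integral_map (hU.prodMk hV).aemeasurable hm.aestronglyMeasurable).symm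
  have : IsProbabilityMeasure (P.map U) := Measure.isProbabilityMeasure_map hU.aemeasurable
  have : IsProbabilityMeasure (P.map V) := Measure.isProbabilityMeasure_map hV.aemeasurable
  rw [e1, hUV.map_prod_eq_prod_map_map hU.aemeasurable hV.aemeasurable,
    integral_prod _ (Integrable.of_bound hm.aestronglyMeasurable 1 (ae_of_all _ fun _ => hF1 _)),
    integral_map hU.aemeasurable hm.stronglyMeasurable.integral_prod_right.aestronglyMeasurable]
  refine integral_congr_ae (ae_of_all _ fun ω => ?_)
  exact integral_map hV.aemeasurable (Measurable.aestronglyMeasurable (by fun_prop))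

lemma integrable_of_abs_le_one (P : Measure Ω) [IsProbabilityMeasure P] {g : Ω → ℝ}
    (hg : Measurable g) (h1 : ∀ x, |g x| ≤ 1) : Integrable g P :=
  Integrable.of_bound hg.aestronglyMeasurable 1 (ae_of_all _ h1)

lemma abs_integral_le_one (P : Measure Ω) [IsProbabilityMeasure P] {g : Ω → ℝ}
    (h1 : ∀ x, |g x| ≤ 1) : |∫ x, g x ∂P| ≤ 1 := by
  simpa using norm_integral_le_of_norm_le_const (μ := P) (f := g) (C := 1) (ae_of_all _ h1)

lemma abs_integral_sub_integral_le (P : Measure Ω) [IsProbabilityMeasure P] {g g' : Ω → ℝ} {c : ℝ}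
    (hg : Integrable g P) (hg' : Integrable g' P) (hc : ∀ x, |g x - g' x| ≤ c) :
    |∫ x, g x ∂P - ∫ x, g' x ∂P| ≤ c := by
  rw [← integral_sub hg hg']
  simpa using norm_integral_le_of_norm_le_const (μ := P) (f := fun x => g x - g' x) (C := c)
    (ae_of_all _ hc)

/-- Discrepancies with respect to translates of a bounded test function add up under sums of
independent vectors. -/
lemma abs_integral_add_sub_le {P : Measure Ω} [IsProbabilityMeasure P] {Q : Measure Ω'}
    [IsProbabilityMeasure Q] {U V : Ω → E → ℝ} {U' V' : Ω' → E → ℝ}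
    (hUV : IndepFun U V P) (hU : Measurable U) (hV : Measurable V)
    (hUV' : IndepFun U' V' Q) (hU' : Measurable U') (hV' : Measurable V')
    {F : (E → ℝ) → ℝ} (hF : Measurable F) (hF1 : ∀ x, |F x| ≤ 1) {ε δ : ℝ}
    (hε : ∀ y, |∫ ω, F (y + U ω) ∂P - ∫ ω, F (y + U' ω) ∂Q| ≤ ε)
    (hδ : ∀ y, |∫ ω, F (y + V ω) ∂P - ∫ ω, F (y + V' ω) ∂Q| ≤ δ) (y : E → ℝ) :
    |∫ ω, F (y + (U ω + V ω)) ∂P - ∫ ω, F (y + (U' ω + V' ω)) ∂Q| ≤ ε + δ := by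
  have mPP : Measurable fun p : Ω × Ω => F (y + (U p.1 + V p.2)) := by fun_prop
  have mPQ : Measurable fun p : Ω × Ω' => F (y + (U p.1 + V' p.2)) := by fun_prop
  have mQP : Measurable fun p : Ω' × Ω => F (y + (U p.2 + V' p.1)) := by fun_prop
  have mQQ : Measurable fun p : Ω' × Ω' => F (y + (U' p.2 + V' p.1)) := by fun_prop
  -- The hybrid `U + V'` lives on the product of the two spaces. With one summand frozen, the other
  -- is exchanged at a shifted base point, which is why the hypotheses hold for every `y`.
  have s1 : |∫ ω, ∫ ω', F (y + (U ω + V ω')) ∂P ∂P - ∫ ω, ∫ ω', F (y + (U ω + V' ω')) ∂Q ∂P|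
      ≤ δ := by
    refine abs_integral_sub_integral_le P
      (integrable_of_abs_le_one P mPP.stronglyMeasurable.integral_prod_right.measurable
        fun _ => abs_integral_le_one P fun _ => hF1 _)
      (integrable_of_abs_le_one P mPQ.stronglyMeasurable.integral_prod_right.measurable
        fun _ => abs_integral_le_one Q fun _ => hF1 _) fun ω => ?_
    simpa only [add_assoc] using hδ (y + U ω)
  have s2 : |∫ ω', ∫ ω, F (y + (U ω + V' ω')) ∂P ∂Q - ∫ ω', ∫ ω, F (y + (U' ω + V' ω')) ∂Q ∂Q|
      ≤ ε := by
    refine abs_integral_sub_integral_le Q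
      (integrable_of_abs_le_one Q mQP.stronglyMeasurable.integral_prod_right.measurable
        fun _ => abs_integral_le_one P fun _ => hF1 _)
      (integrable_of_abs_le_one Q mQQ.stronglyMeasurable.integral_prod_right.measurable
        fun _ => abs_integral_le_one Q fun _ => hF1 _) fun ω => ?_
    have := hε (y + V' ω)
    simp only [add_assoc, add_comm (V' ω)] at this
    exact this
  have sw : ∫ ω, ∫ ω', F (y + (U ω + V' ω')) ∂Q ∂P = ∫ ω', ∫ ω, F (y + (U ω + V' ω')) ∂P ∂Q :=
    integral_integral_swap (integrable_of_abs_le_one (P.prod Q) mPQ fun _ => hF1 _)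
  have e1 := hUV.integral_add_eq hU hV hF hF1 y
  have e2 := hUV'.symm.integral_add_eq hV' hU' hF hF1 y
  simp only [add_comm (V' _)] at e2
  rw [e1, e2]
  rw [sw] at s1
  rw [abs_le] at *
  constructor <;> linarith [s1.1, s1.2, s2.1, s2.2]

/-- The replacement method: discrepancies of independent summands add up. -/
lemma abs_integral_sum_sub_le {ι : Type*} {P : Measure Ω} [IsProbabilityMeasure P] {Q : Measure Ω'}
    [IsProbabilityMeasure Q] {V : ι → Ω → E → ℝ} {W : ι → Ω' → E → ℝ}
    (hV : ∀ ℓ, Measurable (V ℓ)) (hW : ∀ ℓ, Measurable (W ℓ))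
    (hVi : ∀ (s : Finset ι) (ℓ : ι), ℓ ∉ s → IndepFun (fun ω => ∑ k ∈ s, V k ω) (V ℓ) P)
    (hWi : ∀ (s : Finset ι) (ℓ : ι), ℓ ∉ s → IndepFun (fun ω => ∑ k ∈ s, W k ω) (W ℓ) Q)
    {F : (E → ℝ) → ℝ} (hF : Measurable F) (hF1 : ∀ x, |F x| ≤ 1) {ε : ι → ℝ}
    (hε : ∀ ℓ y, |∫ ω, F (y + V ℓ ω) ∂P - ∫ ω, F (y + W ℓ ω) ∂Q| ≤ ε ℓ) (s : Finset ι) :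
    ∀ y : E → ℝ, |∫ ω, F (y + ∑ ℓ ∈ s, V ℓ ω) ∂P - ∫ ω, F (y + ∑ ℓ ∈ s, W ℓ ω) ∂Q|
      ≤ ∑ ℓ ∈ s, ε ℓ := by
  classical
  induction s using Finset.induction_on with
  | empty => simp
  | insert ℓ s hℓ ih =>
    simp only [Finset.sum_insert hℓ]
    have hVs : Measurable fun ω => ∑ k ∈ s, V k ω := Finset.measurable_fun_sum _ fun k _ => hV k
    have hWs : Measurable fun ω => ∑ k ∈ s, W k ω := Finset.measurable_fun_sum _ fun k _ => hW k
    exact abs_integral_add_sub_le (hVi s ℓ hℓ).symm (hV ℓ) hVs (hWi s ℓ hℓ).symm (hW ℓ) hWs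
      hF hF1 (hε ℓ) ih

end Replacement

/-! ### Invariance for independent bucket sums -/

section BucketFamily

variable {n d t : ℕ} {Ω Ω' : Type*} [MeasurableSpace Ω] [MeasurableSpace Ω']

/-- Centred random vectors with given covariances and controlled fourth moments that are 4-wise
independent inside the buckets of `h`, and whose bucket sums are independent. -/
structure IsBucketFamily (h : Fin n → Fin t) (M : Fin n → Fin d → Fin d → ℝ) (v : Fin n → ℝ)
    (κ : ℝ) (Y : Fin n → Ω → EuclideanSpace ℝ (Fin d)) (P : Measure Ω) : Prop where
  measurable : ∀ j, Measurable (Y j)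
  memLp : ∀ j i, MemLp (fun ω => Y j ω i) 4 P
  mean : ∀ j i, ∫ ω, Y j ω i ∂P = 0
  cov : ∀ j i k, ∫ ω, Y j ω i * Y j ω k ∂P = M j i k
  fourth : ∀ j i, ∫ ω, Y j ω i ^ 4 ∂P ≤ κ * v j ^ 2
  fourWise : ∀ ℓ, WiseIndepOn 4 {j | h j = ℓ} Y P
  indep : ∀ (s : Finset (Fin t)) (ℓ : Fin t), ℓ ∉ s →
    IndepFun (fun ω => ∑ k ∈ s, ∑ j with h j = k, Y j ω) (fun ω => ∑ j with h j = ℓ, Y j ω) P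

/-- The total variance of the vectors in a bucket. -/
noncomputable def bucketVar (h : Fin n → Fin t) (v : Fin n → ℝ) (ℓ : Fin t) : ℝ :=
  ∑ j with h j = ℓ, v j

lemma bucketVar_nonneg (h : Fin n → Fin t) {v : Fin n → ℝ} (hv : ∀ j, 0 ≤ v j) (ℓ : Fin t) :
    0 ≤ bucketVar h v ℓ := Finset.sum_nonneg fun j _ => hv j

namespace IsBucketFamily

variable {h : Fin n → Fin t} {M : Fin n → Fin d → Fin d → ℝ} {v : Fin n → ℝ} {κ : ℝ}
  {Y : Fin n → Ω → EuclideanSpace ℝ (Fin d)} {P : Measure Ω}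

lemma memLp_sum (hY : IsBucketFamily h M v κ Y P) (s : Finset (Fin n)) (i : Fin d) :
    MemLp (fun ω => ∑ j ∈ s, Y j ω i) 4 P :=
  memLp_finsetSum _ fun j _ => hY.memLp j i

variable [IsProbabilityMeasure P]

lemma integral_bucket (hY : IsBucketFamily h M v κ Y P) (ℓ : Fin t) (i : Fin d) :
    ∫ ω, ∑ j with h j = ℓ, Y j ω i ∂P = 0 := by
  rw [integral_finsetSum _ fun j _ => integrable_of_memLp_four (hY.memLp j i)]
  exact Finset.sum_eq_zero fun j _ => hY.mean j i

lemma integral_bucket_mul (hY : IsBucketFamily h M v κ Y P) (ℓ : Fin t) (i k : Fin d) :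
    ∫ ω, (∑ j with h j = ℓ, Y j ω i) * ∑ j with h j = ℓ, Y j ω k ∂P =
      ∑ j with h j = ℓ, M j i k := by
  rw [integral_sum_mul_sum _ (fun j => hY.memLp j i) (fun j => hY.memLp j k) fun j => hY.mean j i]
  · exact Finset.sum_congr rfl fun j _ => hY.cov j i k
  · intro a ha b hb hab
    exact ((hY.fourWise ℓ).indepFun_pair hY.measurable (Finset.mem_filter.1 ha).2
      (Finset.mem_filter.1 hb).2 hab).comp (φ := fun x => x i) (ψ := fun x => x k)
      (by fun_prop) (by fun_prop)

/-- In the fourth-moment bound for sums, the single fourth moments contribute `κ` through `∑ v j ^ 2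
≤ (∑ v j) ^ 2`, and the squared variance contributes 3. -/
lemma integral_bucket_pow_four_le (hY : IsBucketFamily h M v κ Y P) (hκ : 0 ≤ κ)
    (hv : ∀ j, 0 ≤ v j) (hM : ∀ j i, M j i i ≤ v j) (ℓ : Fin t) (i : Fin d) :
    ∫ ω, (∑ j with h j = ℓ, Y j ω i) ^ 4 ∂P ≤ (κ + 3) * bucketVar h v ℓ ^ 2 := by
  have h4 := integral_sum_pow_four_le
    ((hY.fourWise ℓ).comp (g := fun x : EuclideanSpace ℝ (Fin d) => x i) (by fun_prop))
    (fun j => (by fun_prop : Measurable fun x : EuclideanSpace ℝ (Fin d) => x i).comp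
      (hY.measurable j)) (fun j => hY.memLp j i) (fun j => hY.mean j i)
    (Finset.univ.filter fun j => h j = ℓ) (fun j hj => (Finset.mem_filter.1 hj).2)
  have h2 : ∀ j, ∫ ω, Y j ω i ^ 2 ∂P = M j i i := fun j => by
    rw [← hY.cov]
    simp_rw [sq]
  have h20 : ∀ j, 0 ≤ M j i i := fun j => by
    rw [← h2]
    exact integral_nonneg fun _ => sq_nonneg _
  have e1 : ∑ j with h j = ℓ, ∫ ω, Y j ω i ^ 4 ∂P ≤ κ * bucketVar h v ℓ ^ 2 := by
    calc ∑ j with h j = ℓ, ∫ ω, Y j ω i ^ 4 ∂P ≤ ∑ j with h j = ℓ, κ * v j ^ 2 :=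
          Finset.sum_le_sum fun j _ => hY.fourth j i
      _ = κ * ∑ j with h j = ℓ, v j ^ 2 := by rw [Finset.mul_sum]
      _ ≤ κ * bucketVar h v ℓ ^ 2 := by
          refine mul_le_mul_of_nonneg_left ?_ hκ
          rw [sq, bucketVar, Finset.sum_mul]
          refine Finset.sum_le_sum fun j hj => ?_
          rw [sq]
          exact mul_le_mul_of_nonneg_left (Finset.single_le_sum (fun j _ => hv j) hj) (hv j)
  have e2 : (∑ j with h j = ℓ, ∫ ω, Y j ω i ^ 2 ∂P) ^ 2 ≤ bucketVar h v ℓ ^ 2 := by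
    simp_rw [h2]
    exact pow_le_pow_left₀ (Finset.sum_nonneg fun j _ => h20 j)
      (Finset.sum_le_sum fun j _ => hM j i) 2
  linarith

lemma integral_abs_bucket_pow_three_le (hY : IsBucketFamily h M v κ Y P) (hκ : 0 ≤ κ)
    (hv : ∀ j, 0 ≤ v j) (hM : ∀ j i, M j i i ≤ v j) (ℓ : Fin t) (i : Fin d) :
    ∫ ω, |∑ j with h j = ℓ, Y j ω i| ^ 3 ∂P ≤
      √(κ + 3) * (bucketVar h v ℓ * √(bucketVar h v ℓ)) := by
  have s0 := bucketVar_nonneg h hv ℓ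
  refine (integral_abs_pow_three_le (hY.memLp_sum _ i)).trans ?_
  have e2 : √(∫ ω, (∑ j with h j = ℓ, Y j ω i) ^ 2 ∂P) ≤ √(bucketVar h v ℓ) := by
    refine Real.sqrt_le_sqrt ?_
    simp_rw [sq]
    rw [hY.integral_bucket_mul]
    exact Finset.sum_le_sum fun j _ => hM j i
  have e4 : √(∫ ω, (∑ j with h j = ℓ, Y j ω i) ^ 4 ∂P) ≤ √(κ + 3) * bucketVar h v ℓ := by
    refine (Real.sqrt_le_sqrt (hY.integral_bucket_pow_four_le hκ hv hM ℓ i)).trans ?_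
    rw [Real.sqrt_mul (by linarith), Real.sqrt_sq s0]
  calc _ ≤ √(bucketVar h v ℓ) * (√(κ + 3) * bucketVar h v ℓ) :=
        mul_le_mul e2 e4 (Real.sqrt_nonneg _) (Real.sqrt_nonneg _)
    _ = _ := by ring

/-- Smooth invariance: two bucket families with the same covariances have nearly the same
expectations of logistic test functions. -/
lemma abs_integral_logisticSum_sub_le (hY : IsBucketFamily h M v κ Y P) {Q : Measure Ω'}
    [IsProbabilityMeasure Q] {G : Fin n → Ω' → EuclideanSpace ℝ (Fin d)}
    (hG : IsBucketFamily h M v κ G Q) (hκ : 0 ≤ κ) (hv : ∀ j, 0 ≤ v j)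
    (hM : ∀ j i, M j i i ≤ v j) {E : Type*} [Fintype E] (c : E → Fin d) (S : Finset (E → Bool))
    (Θ : EuclideanSpace ℝ (Fin d)) {lam : ℝ} (hlam : 0 < lam) :
    |∫ ω, logisticSum S (fun e => lam⁻¹ * ((∑ j, Y j ω) (c e) - Θ (c e))) ∂P
      - ∫ ω, logisticSum S (fun e => lam⁻¹ * ((∑ j, G j ω) (c e) - Θ (c e))) ∂Q| ≤
      10 * (Fintype.card E : ℝ) ^ 3 *
        (lam⁻¹ ^ 3 * (√(κ + 3) * ∑ ℓ, bucketVar h v ℓ * √(bucketVar h v ℓ))) := by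
  let T : EuclideanSpace ℝ (Fin d) → E → ℝ := fun x e => lam⁻¹ * x (c e)
  have hT : Measurable T := by fun_prop
  have Tsum : ∀ {α : Type} (s : Finset α) (f : α → EuclideanSpace ℝ (Fin d)),
      ∑ a ∈ s, T (f a) = T (∑ a ∈ s, f a) := fun s f => by
    ext e
    simp [T, Finset.mul_sum]
  have main := abs_integral_sum_sub_le (P := P) (Q := Q) (F := logisticSum S)
    (V := fun ℓ ω => T (∑ j with h j = ℓ, Y j ω)) (W := fun ℓ ω => T (∑ j with h j = ℓ, G j ω))
    (ε := fun ℓ => 10 * (Fintype.card E : ℝ) ^ 3 *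
        (lam⁻¹ ^ 3 * (√(κ + 3) * (bucketVar h v ℓ * √(bucketVar h v ℓ)))))
    (fun ℓ => hT.comp (Finset.measurable_fun_sum _ fun j _ => hY.measurable j))
    (fun ℓ => hT.comp (Finset.measurable_fun_sum _ fun j _ => hG.measurable j))
    (fun s ℓ hℓ => by
      simp_rw [Tsum]
      exact (hY.indep s ℓ hℓ).comp hT hT)
    (fun s ℓ hℓ => by
      simp_rw [Tsum]
      exact (hG.indep s ℓ hℓ).comp hT hT)
    (continuous_logisticSum S).measurable (abs_logisticSum_le_one S)
    (fun ℓ y => by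
      have T_apply : ∀ (f : Fin n → EuclideanSpace ℝ (Fin d)) e,
          T (∑ j with h j = ℓ, f j) e = lam⁻¹ * ∑ j with h j = ℓ, f j (c e) := fun f e => by
        simp [T]
      refine _root_.abs_integral_logisticSum_sub_le ?_ ?_ ?_ ?_ ?_ ?_ S y <;>
        simp only [T_apply]
      · exact fun e => (hY.memLp_sum _ _).const_mul _
      · exact fun e => (hG.memLp_sum _ _).const_mul _
      · intro e
        rw [integral_const_mul, integral_const_mul, hY.integral_bucket, hG.integral_bucket]
      · intro e f
        have : ∀ a b : ℝ, lam⁻¹ * a * (lam⁻¹ * b) = lam⁻¹ * lam⁻¹ * (a * b) := fun a b => by ring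
        simp_rw [this]
        rw [integral_const_mul, integral_const_mul, hY.integral_bucket_mul, hG.integral_bucket_mul]
      · intro e
        simp_rw [abs_mul, mul_pow, abs_of_pos (inv_pos.2 hlam)]
        rw [integral_const_mul]
        exact mul_le_mul_of_nonneg_left (hY.integral_abs_bucket_pow_three_le hκ hv hM ℓ (c e))
          (by positivity)
      · intro e
        simp_rw [abs_mul, mul_pow, abs_of_pos (inv_pos.2 hlam)]
        rw [integral_const_mul]
        exact mul_le_mul_of_nonneg_left (hG.integral_abs_bucket_pow_three_le hκ hv hM ℓ (c e))
          (by positivity))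
    -- The translation by `Θ` is absorbed in the deterministic base point of the replacement.
    Finset.univ (fun e => -(lam⁻¹ * Θ (c e)))
  have fib : ∀ f : Fin n → EuclideanSpace ℝ (Fin d),
      (fun e => -(lam⁻¹ * Θ (c e))) + ∑ ℓ, T (∑ j with h j = ℓ, f j) =
        fun e => lam⁻¹ * ((∑ j, f j) (c e) - Θ (c e)) := fun f => by
    rw [Tsum, Finset.sum_fiberwise]
    ext e
    simp only [Pi.add_apply, T]
    ring
  simp_rw [fib] at main
  refine main.trans_eq ?_
  rw [Finset.mul_sum, Finset.mul_sum, Finset.mul_sum]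

end IsBucketFamily

end BucketFamily

/-! ### From smooth test functions to unions of orthants -/

section Orthants

variable {d : ℕ}

/-- The vector of signs of the coordinates of `x - Θ`. -/
noncomputable def signVec (Θ x : EuclideanSpace ℝ (Fin d)) (i : Fin d) : Bool :=
  decide (0 ≤ x i - Θ i)

lemma measurable_signVec (Θ : EuclideanSpace ℝ (Fin d)) : Measurable (signVec Θ) := by
  refine measurable_pi_lambda _ fun i => measurable_to_bool ?_
  have : (fun x => signVec Θ x i) ⁻¹' {true} = {x | 0 ≤ x i - Θ i} := by
    ext x
    simp [signVec]
  rw [this]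
  exact measurableSet_le measurable_const (by fun_prop)

lemma IsTranslateOfUnionOfOrthants.exists_signVec {A : Set (EuclideanSpace ℝ (Fin d))}
    (hA : IsTranslateOfUnionOfOrthants A) :
    ∃ (Θ : EuclideanSpace ℝ (Fin d)) (S : Finset (Fin d → Bool)),
      ∀ x, x ∈ A ↔ signVec Θ x ∈ S := by
  classical
  obtain ⟨Θ, hΘ⟩ := hA
  refine ⟨Θ, Finset.univ.filter fun s => ∃ x ∈ A, signVec Θ x = s, fun x => ?_⟩
  simp only [Finset.mem_filter, Finset.mem_univ, true_and]
  refine ⟨fun hx => ⟨x, hx, rfl⟩, fun ⟨x', hx', hs⟩ => (hΘ x' x fun i => ?_).1 hx'⟩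
  have := congrFun hs i
  simp only [signVec, decide_eq_decide] at this
  exact if_congr this rfl rfl

lemma measurableSet_of_signVec {A : Set (EuclideanSpace ℝ (Fin d))}
    {Θ : EuclideanSpace ℝ (Fin d)} {S : Finset (Fin d → Bool)}
    (hA : ∀ x, x ∈ A ↔ signVec Θ x ∈ S) : MeasurableSet A := by
  have : A = signVec Θ ⁻¹' (S : Set (Fin d → Bool)) := Set.ext hA
  rw [this]
  exact measurable_signVec Θ S.measurableSet

lemma IsTranslateOfUnionOfOrthants.measurableSet {A : Set (EuclideanSpace ℝ (Fin d))}
    (hA : IsTranslateOfUnionOfOrthants A) : MeasurableSet A := by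
  obtain ⟨Θ, S, h⟩ := hA.exists_signVec
  exact measurableSet_of_signVec h

lemma boolSign_signVec_mul_nonneg (Θ x : EuclideanSpace ℝ (Fin d)) {lam : ℝ} (hlam : 0 < lam)
    (i : Fin d) : 0 ≤ boolSign (signVec Θ x i) * (lam⁻¹ * (x i - Θ i)) := by
  have := inv_pos.2 hlam
  by_cases hi : 0 ≤ x i - Θ i
  · simp only [signVec, hi, decide_true, boolSign, cond_true]
    positivity
  · simp only [signVec, hi, decide_false, boolSign, cond_false]
    push Not at hi
    nlinarith

/-- The density of the logistic distribution. -/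
noncomputable def logisticDensity (u : ℝ) : ℝ := logisticProb true u * logisticProb false u

lemma logisticDensity_nonneg (u : ℝ) : 0 ≤ logisticDensity u :=
  mul_nonneg (logisticProb_nonneg _ _) (logisticProb_nonneg _ _)

lemma continuous_logisticDensity : Continuous logisticDensity :=
  (continuous_logisticProb _).mul (continuous_logisticProb _)

lemma logisticDensity_le_one (u : ℝ) : logisticDensity u ≤ 1 :=
  mul_le_one₀ (logisticProb_le_one _ _) (logisticProb_nonneg _ _) (logisticProb_le_one _ _)

/-- Two independent signs with the same parameter take prescribed opposite values with probability
`p * (1 - p)`. Thus the boundary weight is itself a test function covered by the replacement bound,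
and anti-concentration is needed only for the Gaussian. -/
lemma logisticSum_singleton_id (u : ℝ) :
    logisticSum {(id : Bool → Bool)} (fun _ => u) = logisticDensity u := by
  simp [logisticSum, logisticDensity]

/-- The probability of a translate of a union of orthants is a logistic expectation, up to the
mass near the boundary. -/
lemma abs_real_sub_integral_logisticSum_le {Ω : Type*} [MeasurableSpace Ω] {P : Measure Ω}
    [IsProbabilityMeasure P] {A : Set (EuclideanSpace ℝ (Fin d))} {Θ : EuclideanSpace ℝ (Fin d)}
    {S : Finset (Fin d → Bool)} (hA : ∀ x, x ∈ A ↔ signVec Θ x ∈ S) {lam : ℝ} (hlam : 0 < lam)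
    {Z : Ω → EuclideanSpace ℝ (Fin d)} (hZ : Measurable Z) :
    |P.real {ω | Z ω ∈ A} - ∫ ω, logisticSum S (fun i => lam⁻¹ * (Z ω i - Θ i)) ∂P| ≤
      2 * ∑ i, ∫ ω, logisticDensity (lam⁻¹ * (Z ω i - Θ i)) ∂P := by
  classical
  have hm : MeasurableSet {ω | Z ω ∈ A} := hZ (measurableSet_of_signVec hA)
  have i1 : Integrable ({ω | Z ω ∈ A}.indicator (1 : Ω → ℝ)) P :=
    (integrable_const (1 : ℝ)).indicator hm
  have mZ : ∀ i, Measurable fun ω => lam⁻¹ * (Z ω i - Θ i) := fun i => by fun_prop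
  have i2 : Integrable (fun ω => logisticSum S (fun i => lam⁻¹ * (Z ω i - Θ i))) P :=
    integrable_of_abs_le_one P ((continuous_logisticSum S).measurable.comp
      (measurable_pi_lambda _ mZ)) fun _ => abs_logisticSum_le_one _ _
  have i3 : ∀ i, Integrable (fun ω => logisticDensity (lam⁻¹ * (Z ω i - Θ i))) P := fun i =>
    integrable_of_abs_le_one P (continuous_logisticDensity.measurable.comp (mZ i)) fun _ => by
      rw [abs_of_nonneg (logisticDensity_nonneg _)]
      exact logisticDensity_le_one _
  rw [← integral_indicator_one hm, ← integral_sub i1 i2, ← integral_finsetSum _ fun i _ => i3 i,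
    ← integral_const_mul]
  refine abs_integral_le_integral_abs.trans (integral_mono (i1.sub i2).abs
    ((integrable_finsetSum _ fun i _ => i3 i).const_mul 2) fun ω => ?_)
  have := abs_ite_sub_logisticSum_le S (signVec Θ (Z ω)) (fun i => lam⁻¹ * (Z ω i - Θ i))
    (boolSign_signVec_mul_nonneg Θ (Z ω) hlam)
  simpa [Set.indicator_apply, hA, logisticDensity] using this

/-- Invariance for translates of unions of orthants, at a fixed smoothing scale. -/
lemma IsBucketFamily.abs_real_sub_le {n t : ℕ} {Ω Ω' : Type*} [MeasurableSpace Ω]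
    [MeasurableSpace Ω'] {h : Fin n → Fin t} {M : Fin n → Fin d → Fin d → ℝ} {v : Fin n → ℝ}
    {κ : ℝ} {Y : Fin n → Ω → EuclideanSpace ℝ (Fin d)} {P : Measure Ω} [IsProbabilityMeasure P]
    (hY : IsBucketFamily h M v κ Y P) {Q : Measure Ω'}
    [IsProbabilityMeasure Q] {G : Fin n → Ω' → EuclideanSpace ℝ (Fin d)}
    (hG : IsBucketFamily h M v κ G Q) (hκ : 0 ≤ κ) (hv : ∀ j, 0 ≤ v j)
    (hM : ∀ j i, M j i i ≤ v j) {A : Set (EuclideanSpace ℝ (Fin d))}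
    (hA : IsTranslateOfUnionOfOrthants A) {lam : ℝ} (hlam : 0 < lam) {δ : ℝ}
    (hanti : ∀ i θ, ∫ ω, logisticDensity (lam⁻¹ * ((∑ j, G j ω) i - θ)) ∂Q ≤ δ) :
    |P.real {ω | ∑ j, Y j ω ∈ A} - Q.real {ω | ∑ j, G j ω ∈ A}| ≤
      4 * (d * δ) + 170 * (d : ℝ) ^ 3 *
        (lam⁻¹ ^ 3 * (√(κ + 3) * ∑ ℓ, bucketVar h v ℓ * √(bucketVar h v ℓ))) := by
  obtain ⟨Θ, S, hS⟩ := hA.exists_signVec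
  set R := lam⁻¹ ^ 3 * (√(κ + 3) * ∑ ℓ, bucketVar h v ℓ * √(bucketVar h v ℓ)) with hR
  have R0 : 0 ≤ R := by
    have : 0 ≤ ∑ ℓ, bucketVar h v ℓ * √(bucketVar h v ℓ) := Finset.sum_nonneg fun ℓ _ =>
      mul_nonneg (bucketVar_nonneg h hv ℓ) (Real.sqrt_nonneg _)
    have := inv_pos.2 hlam
    positivity
  have a1 := abs_real_sub_integral_logisticSum_le (P := P) hS hlam
    (Finset.measurable_fun_sum Finset.univ fun j _ => hY.measurable j)
  have a2 := abs_real_sub_integral_logisticSum_le (P := Q) hS hlam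
    (Finset.measurable_fun_sum Finset.univ fun j _ => hG.measurable j)
  have a3 := hY.abs_integral_logisticSum_sub_le hG hκ hv hM id S Θ hlam
  simp only [id, Fintype.card_fin, ← hR] at a3
  have bG : ∑ i, ∫ ω, logisticDensity (lam⁻¹ * ((∑ j, G j ω) i - Θ i)) ∂Q ≤ d * δ := by
    calc _ ≤ ∑ _i : Fin d, δ := Finset.sum_le_sum fun i _ => hanti i (Θ i)
      _ = d * δ := by simp
  have bY : ∑ i, ∫ ω, logisticDensity (lam⁻¹ * ((∑ j, Y j ω) i - Θ i)) ∂P ≤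
      d * δ + d * (80 * R) := by
    calc _ ≤ ∑ _i : Fin d, (δ + 80 * R) := by
          refine Finset.sum_le_sum fun i _ => ?_
          -- Here `E = Bool` with both signs reading coordinate `i`, so 80 = 10 * 2 ^ 3.
          have := hY.abs_integral_logisticSum_sub_le hG hκ hv hM (fun _ : Bool => i) {id} Θ hlam
          simp only [logisticSum_singleton_id, Fintype.card_bool, ← hR] at this
          push_cast at this
          linarith [(abs_le.1 this).2, hanti i (Θ i)]
      _ = d * δ + d * (80 * R) := by simp
  -- Absorbs the boundary error `2 * d * 80 * R` into the main error `10 * d ^ 3 * R`, giving 170.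
  have d3 : (d : ℝ) ≤ (d : ℝ) ^ 3 := by
    exact_mod_cast Nat.le_self_pow three_ne_zero d
  have : (d : ℝ) * R ≤ (d : ℝ) ^ 3 * R := mul_le_mul_of_nonneg_right d3 R0
  rw [abs_le] at *
  constructor <;> linarith [a1.1, a1.2, a2.1, a2.2, a3.1, a3.2]

end Orthants

/-! ### Gaussian anti-concentration and the Gaussian bucket family -/

section Gaussian

/-- The exponential tail is weakened, through `1 + x + x ^ 2 / 2 ≤ exp x`, to a Cauchy tail whose
integral is explicit. -/
lemma logisticProb_le_of_nonneg (s : Bool) {u : ℝ} (h : 0 ≤ -(boolSign s * u)) :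
    logisticProb s u ≤ 2 * (1 + u ^ 2)⁻¹ := by
  have hu : (-(boolSign s * u)) ^ 2 = u ^ 2 := by
    linear_combination u ^ 2 * boolSign_mul_self s
  have := Real.quadratic_le_exp_of_nonneg h
  rw [hu] at this
  rw [logisticProb, Real.sigmoid_def, ← div_eq_mul_inv, inv_eq_one_div,
    div_le_div_iff₀ (by positivity) (by positivity)]
  linarith

lemma logisticDensity_le (u : ℝ) : logisticDensity u ≤ 2 * (1 + u ^ 2)⁻¹ := by
  rcases le_total 0 u with hu | hu
  · exact (mul_le_of_le_one_left (logisticProb_nonneg _ _) (logisticProb_le_one _ _)).trans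
      (logisticProb_le_of_nonneg false (by simpa [boolSign] using hu))
  · exact (mul_le_of_le_one_right (logisticProb_nonneg _ _) (logisticProb_le_one _ _)).trans
      (logisticProb_le_of_nonneg true (by simpa [boolSign] using hu))

/-- Anti-concentration of the standard Gaussian. -/
lemma integral_logisticDensity_gaussianReal_le {lam : ℝ} (hlam : 0 < lam) (θ : ℝ) :
    ∫ x, logisticDensity (lam⁻¹ * (x - θ)) ∂(gaussianReal 0 1) ≤ 8 * lam := by
  let g : ℝ → ℝ := fun u => 2 * (1 + u ^ 2)⁻¹
  have ig : Integrable fun x => g (lam⁻¹ * (x - θ)) :=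
    ((integrable_inv_one_add_sq.const_mul 2).comp_mul_left' (inv_ne_zero hlam.ne')).comp_sub_right θ
  rw [integral_gaussianReal_eq_integral_smul one_ne_zero]
  have pdf : ∀ x, gaussianPDFReal 0 1 x ≤ 1 := fun x => by
    rw [gaussianPDFReal]
    refine mul_le_one₀ (inv_le_one_of_one_le₀ ?_) (Real.exp_nonneg _) (Real.exp_le_one_iff.2 ?_)
    · rw [Real.one_le_sqrt]
      simp only [NNReal.coe_one, mul_one]
      linarith [Real.pi_gt_three]
    · simp only [NNReal.coe_one, mul_one, sub_zero]
      linarith [sq_nonneg x]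
  calc ∫ x, gaussianPDFReal 0 1 x • logisticDensity (lam⁻¹ * (x - θ))
      ≤ ∫ x, g (lam⁻¹ * (x - θ)) := by
        refine integral_mono_of_nonneg (ae_of_all _ fun x =>
          mul_nonneg (gaussianPDFReal_nonneg _ _ _) (logisticDensity_nonneg _)) ig
          (ae_of_all _ fun x => ?_)
        exact (mul_le_of_le_one_left (logisticDensity_nonneg _) (pdf x)).trans (logisticDensity_le _)
    _ = ∫ x, g (lam⁻¹ * x) := integral_sub_right_eq_self (fun x => g (lam⁻¹ * x)) θ
    _ = lam * (2 * Real.pi) := by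
        rw [Measure.integral_comp_mul_left, inv_inv, abs_of_pos hlam, smul_eq_mul,
          integral_const_mul, integral_univ_inv_one_add_sq]
    _ ≤ 8 * lam := by nlinarith [Real.pi_le_four]

/-- The fourth moment of the standard Gaussian. -/
noncomputable def gaussianFourthMoment : ℝ := ∫ x, x ^ 4 ∂(gaussianReal 0 1)

lemma gaussianFourthMoment_nonneg : 0 ≤ gaussianFourthMoment :=
  integral_nonneg fun x => by positivity

lemma integral_pow_four_gaussianReal (w : NNReal) :
    ∫ x, x ^ 4 ∂(gaussianReal 0 w) = (w : ℝ) ^ 2 * gaussianFourthMoment := by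
  -- Scaling a standard Gaussian by `√w` also covers the degenerate case `w = 0`.
  have h := gaussianReal_map_const_mul (μ := 0) (v := 1) (√(w : ℝ))
  have hw : NNReal.mk (√(w : ℝ) ^ 2) (sq_nonneg _) * 1 = w := by
    ext
    simp
  rw [mul_zero, hw] at h
  rw [← h, integral_map (by fun_prop) (by fun_prop), gaussianFourthMoment, ← integral_const_mul]
  refine integral_congr_ae (ae_of_all _ fun x => ?_)
  have : √(w : ℝ) ^ 4 = (w : ℝ) ^ 2 := by
    rw [show (4 : ℕ) = 2 * 2 from rfl, pow_mul, Real.sq_sqrt w.coe_nonneg]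
  simp only [mul_pow √(w : ℝ), this]

variable {n d t : ℕ}

lemma ProbabilityTheory.iIndepFun.wiseIndepOn {ι Ω E : Type*} [MeasurableSpace Ω] [MeasurableSpace E]
    {P : Measure Ω} {Y : ι → Ω → E} (h : iIndepFun Y P) (r : ℕ) (B : Set ι) :
    WiseIndepOn r B Y P := fun _ _ _ => h.precomp Subtype.val_injective

lemma ProbabilityTheory.iIndepFun.indepFun_bucket_sums {Ω : Type*} [MeasurableSpace Ω] {P : Measure Ω}
    {Y : Fin n → Ω → EuclideanSpace ℝ (Fin d)} (hi : iIndepFun Y P) (hm : ∀ j, Measurable (Y j))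
    (h : Fin n → Fin t) (s : Finset (Fin t)) {ℓ : Fin t} (hℓ : ℓ ∉ s) :
    IndepFun (fun ω => ∑ k ∈ s, ∑ j with h j = k, Y j ω) (fun ω => ∑ j with h j = ℓ, Y j ω) P := by
  have hd : Disjoint (Finset.univ.filter fun j => h j ∈ s)
      (Finset.univ.filter fun j => h j = ℓ) := by
    rw [Finset.disjoint_filter]
    rintro j - hj rfl
    exact hℓ hj
  have := (hi.indepFun_finset _ _ hd hm).comp (φ := fun f => ∑ j, f j) (ψ := fun f => ∑ j, f j)
    (by fun_prop) (by fun_prop)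
  refine this.congr (ae_of_all _ fun ω => ?_) (ae_of_all _ fun ω => ?_)
  · simp only [Function.comp_apply]
    rw [Finset.sum_coe_sort _ fun j => Y j ω,
      ← Finset.sum_fiberwise_of_maps_to (s := Finset.univ.filter fun j => h j ∈ s) (t := s) (g := h)
      (fun j hj => (Finset.mem_filter.1 hj).2)]
    refine Finset.sum_congr rfl fun k hk => Finset.sum_congr ?_ fun _ _ => rfl
    ext j
    simp only [Finset.mem_filter, Finset.mem_univ, true_and]
    exact ⟨fun h => h.2, fun h => ⟨h ▸ hk, h⟩⟩
  · simp only [Function.comp_apply]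
    rw [Finset.sum_coe_sort _ fun j => Y j ω]

lemma isBucketFamily_multivariateGaussian {S : Fin n → Matrix (Fin d) (Fin d) ℝ}
    (hS : ∀ j, (S j).PosSemidef) {v : Fin n → ℝ} (hv : ∀ j i, S j i i ≤ v j) {κ : ℝ}
    (hκ : gaussianFourthMoment ≤ κ) (h : Fin n → Fin t) :
    IsBucketFamily h (fun j i k => S j i k) v κ (fun j x => x j)
      (Measure.pi fun j => multivariateGaussian 0 (S j)) := by
  have mp : ∀ j, MeasurePreserving (fun x : Fin n → EuclideanSpace ℝ (Fin d) => x j)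
      (Measure.pi fun j => multivariateGaussian 0 (S j)) (multivariateGaussian 0 (S j)) :=
    fun j => measurePreserving_eval _ j
  have mpi : ∀ j i, MeasurePreserving (fun x : Fin n → EuclideanSpace ℝ (Fin d) => x j i)
      (Measure.pi fun j => multivariateGaussian 0 (S j)) (gaussianReal 0 (S j i i).toNNReal) :=
    fun j i => by
      simpa using! (measurePreserving_eval_multivariateGaussian (μ := 0) (hS j) (i := i)).comp (mp j)
  have ind : iIndepFun (fun j (x : Fin n → EuclideanSpace ℝ (Fin d)) => x j)
      (Measure.pi fun j => multivariateGaussian 0 (S j)) :=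
    iIndepFun_pi (X := fun _ x => x) fun j => aemeasurable_id
  have mean : ∀ j i, ∫ x : Fin n → EuclideanSpace ℝ (Fin d), x j i
      ∂(Measure.pi fun j => multivariateGaussian 0 (S j)) = 0 := fun j i => by
    rw [← integral_map (f := fun x : ℝ => x) (mpi j i).aemeasurable (by fun_prop), (mpi j i).map_eq]
    exact integral_id_gaussianReal
  have mem : ∀ j i, MemLp (fun x : Fin n → EuclideanSpace ℝ (Fin d) => x j i) 4
      (Measure.pi fun j => multivariateGaussian 0 (S j)) := fun j i =>
    (memLp_id_gaussianReal' 4 (by norm_num)).comp_measurePreserving (mpi j i)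
  refine ⟨fun j => measurable_pi_apply j, mem, mean, fun j i k => ?_, fun j i => ?_,
    fun ℓ => ind.wiseIndepOn 4 _,
    fun s ℓ hℓ => ind.indepFun_bucket_sums (fun j => measurable_pi_apply j) h s hℓ⟩
  · have h2 : ∀ i, MemLp (fun x : Fin n → EuclideanSpace ℝ (Fin d) => x j i) 2
        (Measure.pi fun j => multivariateGaussian 0 (S j)) := fun i =>
      (mem j i).mono_exponent (by norm_num)
    have := covariance_eval_multivariateGaussian (μ := 0) (hS j) i k
    rw [← (mp j).map_eq, covariance_map (by fun_prop) (by fun_prop)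
      (mp j).measurable.aemeasurable] at this
    change covariance (fun x : Fin n → EuclideanSpace ℝ (Fin d) => x j i) (fun x => x j k) _ = _
      at this
    rw [covariance_eq_sub (h2 i) (h2 k), mean, zero_mul, sub_zero] at this
    exact this
  · have := integral_map (f := fun x : ℝ => x ^ 4) (mpi j i).aemeasurable (by fun_prop)
    rw [← this, (mpi j i).map_eq, integral_pow_four_gaussianReal,
      Real.coe_toNNReal _ ((hS j).diag_nonneg), mul_comm]
    exact mul_le_mul hκ (pow_le_pow_left₀ ((hS j).diag_nonneg) (hv j i) 2) (sq_nonneg _)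
      (gaussianFourthMoment_nonneg.trans hκ)

lemma integral_logisticDensity_multivariateGaussian_le {S : Fin n → Matrix (Fin d) (Fin d) ℝ}
    (hS : ∀ j, (S j).PosSemidef) (hS1 : ∀ i, ∑ j, S j i i = 1) {lam : ℝ} (hlam : 0 < lam)
    (i : Fin d) (θ : ℝ) :
    ∫ x, logisticDensity (lam⁻¹ * ((∑ j, x j : EuclideanSpace ℝ (Fin d)) i - θ))
      ∂(Measure.pi fun j => multivariateGaussian 0 (S j)) ≤ 8 * lam := by
  -- Putting everything in a single bucket lets the bucket moment formulas supply the mean 0 and the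
  -- variance 1 of a coordinate of the full sum.
  have fam := isBucketFamily_multivariateGaussian (t := 1) (v := fun j => ∑ i, S j i i) hS
    (fun j i => Finset.single_le_sum (f := fun i => S j i i)
      (fun i _ => (hS j).diag_nonneg) (Finset.mem_univ i))
    le_rfl fun _ => 0
  set γ := Measure.pi fun j => multivariateGaussian 0 (S j) with hγ
  have ind : iIndepFun (fun j (x : Fin n → EuclideanSpace ℝ (Fin d)) => x j i) γ :=
    iIndepFun_pi (X := fun _ (x : EuclideanSpace ℝ (Fin d)) => x i) fun j => by fun_prop
  have hl : HasGaussianLaw (fun x : Fin n → EuclideanSpace ℝ (Fin d) => ∑ j, x j i) γ := by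
    refine ind.hasGaussianLaw_fun_sum fun j => ?_
    have hj : HasGaussianLaw (fun x : Fin n → EuclideanSpace ℝ (Fin d) => x j) γ :=
      (⟨(measurable_pi_apply j).aemeasurable, (measurePreserving_eval _ j).map_eq⟩ :
        HasLaw (fun x : Fin n → EuclideanSpace ℝ (Fin d) => x j)
          (multivariateGaussian 0 (S j)) γ).hasGaussianLaw
    exact hj.map_fun (EuclideanSpace.proj i)
  have hmeas : Measurable fun x : Fin n → EuclideanSpace ℝ (Fin d) => ∑ j, x j i := by fun_prop
  have m0 : ∫ x : Fin n → EuclideanSpace ℝ (Fin d), ∑ j, x j i ∂γ = 0 := by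
    simpa using fam.integral_bucket 0 i
  have m2 : Var[fun x : Fin n → EuclideanSpace ℝ (Fin d) => ∑ j, x j i; γ] = 1 := by
    rw [variance_of_integral_eq_zero hmeas.aemeasurable m0]
    have := fam.integral_bucket_mul 0 i i
    simp only [Finset.filter_true, hS1] at this
    rw [← this]
    simp_rw [sq]
  have law := hl.map_eq_gaussianReal
  rw [m0, m2, Real.toNNReal_one] at law
  have e := integral_map (μ := γ) (φ := fun x : Fin n → EuclideanSpace ℝ (Fin d) => ∑ j, x j i)
    (f := fun u => logisticDensity (lam⁻¹ * (u - θ))) hmeas.aemeasurable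
    (continuous_logisticDensity.comp (by fun_prop)).aestronglyMeasurable
  have e' : ∀ x : Fin n → EuclideanSpace ℝ (Fin d), (∑ j, x j) i = ∑ j, x j i := fun x => by simp
  simp_rw [e']
  rw [← e, law]
  exact integral_logisticDensity_gaussianReal_le hlam θ

end Gaussian

/-! ### Hypercontractive samples for a fixed seed, and averaging over seeds -/

section HashedSample

variable {n d t : ℕ} {Ω Ω' : Type*} [MeasurableSpace Ω] [MeasurableSpace Ω'] {η : ℝ}
  {P : Measure Ω}

lemma IsHC.memLp_eval {X : Ω → EuclideanSpace ℝ (Fin d)} (hX : IsHC η X P) (i : Fin d) :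
    MemLp (fun ω => X ω i) 4 P :=
  (EuclideanSpace.proj (𝕜 := ℝ) i).comp_memLp' hX.2.2.1

/-- The hypercontractive inequality at `a = 0`; no other value of `a` is needed. -/
lemma IsHC.integral_norm_pow_four_le {X : Ω → EuclideanSpace ℝ (Fin d)} (hX : IsHC η X P) :
    ∫ ω, ‖X ω‖ ^ 4 ∂P ≤ η⁻¹ ^ 4 * sqNormL2 X P ^ 2 := by
  have h := hX.2.2.2 0
  simp only [zero_add, norm_smul, mul_pow] at h
  have η0 : (0 : ℝ) < ‖η‖ ^ 4 := pow_pos (norm_pos_iff.2 hX.1.ne') 4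
  rw [integral_const_mul, ← le_div_iff₀' η0, Real.norm_of_nonneg hX.1.le] at h
  rwa [sqNormL2, inv_pow, ← div_eq_inv_mul]

lemma sqNormL2_nonneg (X : Ω → EuclideanSpace ℝ (Fin d)) (P : Measure Ω) : 0 ≤ sqNormL2 X P :=
  integral_nonneg fun _ => sq_nonneg _

lemma IsHC.integral_eval_pow_four_le {X : Ω → EuclideanSpace ℝ (Fin d)} (hX : IsHC η X P)
    (i : Fin d) : ∫ ω, X ω i ^ 4 ∂P ≤ η⁻¹ ^ 4 * sqNormL2 X P ^ 2 := by
  refine le_trans ?_ hX.integral_norm_pow_four_le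
  refine integral_mono_of_nonneg (ae_of_all _ fun ω => by positivity)
    (hX.2.2.1.integrable_norm_pow (by norm_num)) (ae_of_all _ fun ω => ?_)
  have := pow_le_pow_left₀ (norm_nonneg _) (PiLp.norm_apply_le (X ω) i) 4
  rwa [Real.norm_eq_abs, (by decide : Even 4).pow_abs] at this

lemma IsHashedSample.indepFun_bucket_sums {K : Type*} [Fintype K] {hash : K → Fin n → Fin t}
    {X : Fin n → Ω → EuclideanSpace ℝ (Fin d)} {seed : Ω' → K}
    {Y : Fin n → Ω' → EuclideanSpace ℝ (Fin d)} {Q : Measure Ω'}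
    (hY : IsHashedSample hash X P seed Y Q) (k : K) (s : Finset (Fin t)) {ℓ : Fin t}
    (hℓ : ℓ ∉ s) :
    IndepFun (fun ω => ∑ m ∈ s, ∑ j with hash k j = m, Y j ω)
      (fun ω => ∑ j with hash k j = ℓ, Y j ω) (cond Q (seed ⁻¹' {k})) := by
  have hd : Disjoint s {ℓ} := by simpa using hℓ
  have hm := hY.measurable
  have := ((hY.indep_buckets k).indepFun_finset s {ℓ} hd (fun m => by fun_prop)).comp
    (φ := fun f => ∑ m, ∑ j, f m j) (ψ := fun f => ∑ m, ∑ j, f m j) (by fun_prop) (by fun_prop)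
  have e : ∀ (m : Fin t) (ω : Ω'), ∑ j : {j // hash k j = m}, Y j ω =
      ∑ j with hash k j = m, Y j ω := fun m ω =>
    (Finset.sum_subtype _ (by simp) fun j => Y j ω).symm
  refine this.congr (ae_of_all _ fun ω => ?_) (ae_of_all _ fun ω => ?_)
  · simp only [Function.comp_apply, e]
    exact Finset.sum_coe_sort s fun m => ∑ j with hash k j = m, Y j ω
  · simp only [Function.comp_apply, e]
    rw [Finset.sum_coe_sort {ℓ} fun m => ∑ j with hash k j = m, Y j ω, Finset.sum_singleton]

/-- The law of total probability for a uniform seed. -/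
lemma IsHashedSample.real_eq_sum_cond {K : Type*} [Fintype K] [Nonempty K]
    {hash : K → Fin n → Fin t} {X : Fin n → Ω → EuclideanSpace ℝ (Fin d)} {seed : Ω' → K}
    {Y : Fin n → Ω' → EuclideanSpace ℝ (Fin d)} {Q : Measure Ω'} [IsProbabilityMeasure Q]
    (hY : IsHashedSample hash X P seed Y Q) {B : Set Ω'} (hB : MeasurableSet B) :
    Q.real B = (∑ k, (cond Q (seed ⁻¹' {k})).real B) / Fintype.card K := by
  have h1 : Q.real B = ∑ k, Q.real (seed ⁻¹' {k} ∩ B) := by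
    have hU : B = ⋃ k ∈ Finset.univ, seed ⁻¹' {k} ∩ B := by
      ext ω
      simp
    conv_lhs => rw [hU]
    refine measureReal_biUnion_finset ?_ fun k _ => (hY.measurableSet_seed k).inter hB
    intro k _ l _ hkl
    refine Set.disjoint_left.2 fun ω h1 h2 => hkl ?_
    rw [← h1.1, ← h2.1]
  rw [h1, Finset.sum_div]
  refine Finset.sum_congr rfl fun k _ => ?_
  rw [measureReal_def, ← cond_mul_eq_inter (hY.measurableSet_seed k), ENNReal.toReal_mul,
    ← measureReal_def, ← measureReal_def, hY.uniform_seed, mul_one_div]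

variable [IsProbabilityMeasure P]

lemma IsHC.integrable {X : Ω → EuclideanSpace ℝ (Fin d)} (hX : IsHC η X P) : Integrable X P :=
  hX.2.2.1.integrable (by norm_num)

lemma IsHC.integral_eval {X : Ω → EuclideanSpace ℝ (Fin d)} (hX : IsHC η X P)
    (h0 : ∫ ω, X ω ∂P = 0) (i : Fin d) : ∫ ω, X ω i ∂P = 0 := by
  have := (EuclideanSpace.proj (𝕜 := ℝ) i).integral_comp_comm hX.integrable
  rw [h0, map_zero] at this
  exact this

lemma IsHC.covMat_apply {X : Ω → EuclideanSpace ℝ (Fin d)} (hX : IsHC η X P)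
    (h0 : ∫ ω, X ω ∂P = 0) (i k : Fin d) : covMat X P i k = ∫ ω, X ω i * X ω k ∂P := by
  rw [covMat, Matrix.of_apply, covariance_eq_sub ((hX.memLp_eval i).mono_exponent (by norm_num))
    ((hX.memLp_eval k).mono_exponent (by norm_num)), hX.integral_eval h0, zero_mul, sub_zero]
  rfl

lemma IsHC.posSemidef_covMat {X : Ω → EuclideanSpace ℝ (Fin d)} (hX : IsHC η X P)
    (h0 : ∫ ω, X ω ∂P = 0) : (covMat X P).PosSemidef := by
  refine Matrix.PosSemidef.of_dotProduct_mulVec_nonneg ?_ fun x => ?_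
  · ext i k
    simp only [Matrix.conjTranspose_apply, star_trivial, hX.covMat_apply h0, mul_comm]
  · have : star x ⬝ᵥ Matrix.mulVec (covMat X P) x = ∫ ω, (∑ i, x i * X ω i) ^ 2 ∂P := by
      simp only [dotProduct, Matrix.mulVec, star_trivial, hX.covMat_apply h0, sq,
        Finset.sum_mul_sum]
      rw [integral_finsetSum _ fun i _ => integrable_finsetSum _ fun k _ =>
        integrable_mul_two ((hX.memLp_eval i).const_mul _) ((hX.memLp_eval k).const_mul _)]
      refine Finset.sum_congr rfl fun i _ => ?_
      rw [integral_finsetSum _ fun k _ =>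
        integrable_mul_two ((hX.memLp_eval i).const_mul _) ((hX.memLp_eval k).const_mul _),
        Finset.mul_sum]
      refine Finset.sum_congr rfl fun k _ => ?_
      have : ∀ ω, x i * X ω i * (x k * X ω k) = x i * x k * (X ω i * X ω k) := fun ω => by ring
      simp_rw [this]
      rw [integral_const_mul]
      ring
    rw [this]
    exact integral_nonneg fun _ => sq_nonneg _

lemma IsHC.sum_integral_sq {X : Ω → EuclideanSpace ℝ (Fin d)} (hX : IsHC η X P) :
    ∑ i, ∫ ω, X ω i ^ 2 ∂P = sqNormL2 X P := by
  rw [← integral_finsetSum _ fun i _ => ?_]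
  · simp_rw [sqNormL2, EuclideanSpace.real_norm_sq_eq]
  · simpa [sq] using integrable_mul_two (hX.memLp_eval i) (hX.memLp_eval i)

lemma IsHC.covMat_diag {X : Ω → EuclideanSpace ℝ (Fin d)} (hX : IsHC η X P)
    (h0 : ∫ ω, X ω ∂P = 0) (i : Fin d) : covMat X P i i = ∫ ω, X ω i ^ 2 ∂P := by
  simp_rw [hX.covMat_apply h0, sq]

lemma IsHC.covMat_diag_le {X : Ω → EuclideanSpace ℝ (Fin d)} (hX : IsHC η X P)
    (h0 : ∫ ω, X ω ∂P = 0) (i : Fin d) : covMat X P i i ≤ sqNormL2 X P := by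
  rw [hX.covMat_diag h0, ← hX.sum_integral_sq]
  exact Finset.single_le_sum (f := fun i => ∫ ω, X ω i ^ 2 ∂P)
    (fun i _ => integral_nonneg fun _ => sq_nonneg _) (Finset.mem_univ i)

/-- Vectors distributed as centred hypercontractive ones, with 4-wise independence inside buckets
and independent bucket sums. -/
lemma isBucketFamily_of_identDistrib {X : Fin n → Ω → EuclideanSpace ℝ (Fin d)}
    (hX : ∀ j, IsHC η (X j) P) (h0 : ∀ j, ∫ ω, X j ω ∂P = 0) {κ : ℝ} (hκ : η⁻¹ ^ 4 ≤ κ)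
    {P' : Measure Ω'} {Y : Fin n → Ω' → EuclideanSpace ℝ (Fin d)}
    (hm : ∀ j, Measurable (Y j)) (hid : ∀ j, IdentDistrib (Y j) (X j) P' P) {h : Fin n → Fin t}
    (h4 : ∀ ℓ, WiseIndepOn 4 {j | h j = ℓ} Y P')
    (hi : ∀ (s : Finset (Fin t)) (ℓ : Fin t), ℓ ∉ s → IndepFun
      (fun ω => ∑ k ∈ s, ∑ j with h j = k, Y j ω) (fun ω => ∑ j with h j = ℓ, Y j ω) P') :
    IsBucketFamily h (fun j i k => covMat (X j) P i k) (fun j => sqNormL2 (X j) P) κ Y P' where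
  measurable := hm
  memLp j i := ((hid j).comp (u := fun x : EuclideanSpace ℝ (Fin d) => x i)
    (by fun_prop)).symm.memLp_snd ((hX j).memLp_eval i)
  mean j i := by
    rw [← (hX j).integral_eval (h0 j) i]
    exact ((hid j).comp (u := fun x => x i) (by fun_prop)).integral_eq
  cov j i k := by
    rw [(hX j).covMat_apply (h0 j)]
    exact ((hid j).comp (u := fun x => x i * x k) (by fun_prop)).integral_eq
  fourth j i := by
    have := ((hid j).comp (u := fun x => x i ^ 4) (by fun_prop)).integral_eq
    simp only [Function.comp_apply] at this
    rw [this]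
    exact ((hX j).integral_eval_pow_four_le i).trans
      (mul_le_mul_of_nonneg_right hκ (sq_nonneg _))
  fourWise := h4
  indep := hi

/-- The law of a sum of Gaussian vectors with given covariances, for a fixed hash function, is
close to the law of the sum of a bucket family. -/
lemma abs_real_sub_gaussian_le {X : Fin n → Ω → EuclideanSpace ℝ (Fin d)}
    (hX : ∀ j, IsHC η (X j) P) (h0 : ∀ j, ∫ ω, X j ω ∂P = 0)
    (h1 : ∀ i, ∑ j, ∫ ω, (X j ω i) ^ 2 ∂P = 1) (hη : 0 < η) (hη1 : η ≤ 1)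
    {P' : Measure Ω'} [IsProbabilityMeasure P'] {Y : Fin n → Ω' → EuclideanSpace ℝ (Fin d)}
    (hm : ∀ j, Measurable (Y j)) (hid : ∀ j, IdentDistrib (Y j) (X j) P' P) {h : Fin n → Fin t}
    (h4 : ∀ ℓ, WiseIndepOn 4 {j | h j = ℓ} Y P')
    (hi : ∀ (s : Finset (Fin t)) (ℓ : Fin t), ℓ ∉ s → IndepFun
      (fun ω => ∑ k ∈ s, ∑ j with h j = k, Y j ω) (fun ω => ∑ j with h j = ℓ, Y j ω) P')
    {A : Set (EuclideanSpace ℝ (Fin d))} (hA : IsTranslateOfUnionOfOrthants A)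
    {lam α : ℝ} (hlam : 0 < lam) (hα : 0 < α) :
    |P'.real {ω | ∑ j, Y j ω ∈ A} - (Measure.pi fun j =>
        multivariateGaussian 0 (covMat (X j) P)).real {x | ∑ j, x j ∈ A}| ≤
      32 * (d * lam) + 85 * √(gaussianFourthMoment + 4) * ((d : ℝ) ^ 3 * lam⁻¹ ^ 3 * η⁻¹ ^ 2 *
        (α * d + α⁻¹ * ∑ ℓ, bucketVar h (fun j => sqNormL2 (X j) P) ℓ ^ 2)) := by
  -- One constant has to dominate the fourth-moment ratios of both families, while `√(κ + 3)` stays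
  -- of order `η⁻¹ ^ 2`; both use `η ≤ 1`.
  set κ := (gaussianFourthMoment + 1) * η⁻¹ ^ 4 with hκdef
  have m0 := gaussianFourthMoment_nonneg
  have η1 : 1 ≤ η⁻¹ := (one_le_inv₀ hη).2 hη1
  have η4 : 1 ≤ η⁻¹ ^ 4 := one_le_pow₀ η1
  have hκ1 : η⁻¹ ^ 4 ≤ κ := by rw [hκdef]; nlinarith
  have hκ2 : gaussianFourthMoment ≤ κ := by rw [hκdef]; nlinarith
  have hκ3 : √(κ + 3) ≤ √(gaussianFourthMoment + 4) * η⁻¹ ^ 2 := by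
    refine Real.sqrt_le_iff.2 ⟨by positivity, ?_⟩
    rw [mul_pow, Real.sq_sqrt (by linarith), hκdef]
    nlinarith
  have hS := fun j => (hX j).posSemidef_covMat (h0 j)
  have hS1 : ∀ i, ∑ j, covMat (X j) P i i = 1 := fun i => by
    rw [← h1 i]
    exact Finset.sum_congr rfl fun j _ => (hX j).covMat_diag (h0 j) i
  have hdiag := fun j i => (hX j).covMat_diag_le (h0 j) i
  set v : Fin n → ℝ := fun j => sqNormL2 (X j) P with hv
  have v0 : ∀ j, 0 ≤ v j := fun j => sqNormL2_nonneg _ _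
  have famY := isBucketFamily_of_identDistrib hX h0 hκ1 hm hid h4 hi
  have famG := isBucketFamily_multivariateGaussian hS hdiag hκ2 h
  have main := famY.abs_real_sub_le famG (by linarith) v0 hdiag hA hlam
    (integral_logisticDensity_multivariateGaussian_le hS hS1 hlam)
  have sumv : ∑ ℓ, bucketVar h v ℓ = d := by
    simp only [bucketVar]
    rw [Finset.sum_fiberwise]
    simp only [hv, ← (hX _).sum_integral_sq]
    rw [Finset.sum_comm]
    simp [h1]
  -- Weighted arithmetic-geometric mean in each bucket: the difference of the two sides is a
  -- multiple of `(α - √s) ^ 2`. The result is linear in `∑ s ^ 2`, hence can be averaged over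
  -- seeds.
  have W : ∑ ℓ, bucketVar h v ℓ * √(bucketVar h v ℓ) ≤
      (α * d + α⁻¹ * ∑ ℓ, bucketVar h v ℓ ^ 2) / 2 := by
    rw [← sumv, Finset.mul_sum, Finset.mul_sum, ← Finset.sum_add_distrib, Finset.sum_div]
    refine Finset.sum_le_sum fun ℓ _ => ?_
    have s0 := bucketVar_nonneg h v0 ℓ
    set s := bucketVar h v ℓ
    have e : α * s + α⁻¹ * s ^ 2 - 2 * (s * √s) = α⁻¹ * s * (α - √s) ^ 2 := by
      field_simp
      linear_combination (-s) * Real.sq_sqrt s0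
    have : 0 ≤ α⁻¹ * s * (α - √s) ^ 2 := by positivity
    linarith
  refine main.trans ?_
  have W0 : 0 ≤ ∑ ℓ, bucketVar h v ℓ * √(bucketVar h v ℓ) := Finset.sum_nonneg fun ℓ _ =>
    mul_nonneg (bucketVar_nonneg h v0 ℓ) (Real.sqrt_nonneg _)
  calc _ ≤ 4 * (d * (8 * lam)) + 170 * (d : ℝ) ^ 3 * (lam⁻¹ ^ 3 *
        (√(gaussianFourthMoment + 4) * η⁻¹ ^ 2 *
          ((α * d + α⁻¹ * ∑ ℓ, bucketVar h v ℓ ^ 2) / 2))) := by gcongr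
    _ = _ := by ring

/-- Choice of the smoothing scale and of the weight in the Cauchy–Schwarz inequality. -/
lemma exists_scale {d η M : ℝ} (hd : 0 < d) (hη : 0 < η) (hM : 0 < M) :
    ∃ lam α : ℝ, 0 < lam ∧ 0 < α ∧
      d * lam = η ^ (-(1 / 2) : ℝ) * d ^ (13 / 8 : ℝ) * M ^ (1 / 8 : ℝ) ∧
      d ^ 3 * lam⁻¹ ^ 3 * η⁻¹ ^ 2 * (α * d) =
        η ^ (-(1 / 2) : ℝ) * d ^ (13 / 8 : ℝ) * M ^ (1 / 8 : ℝ) ∧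
      d ^ 3 * lam⁻¹ ^ 3 * η⁻¹ ^ 2 * (α⁻¹ * M) =
        η ^ (-(1 / 2) : ℝ) * d ^ (13 / 8 : ℝ) * M ^ (1 / 8 : ℝ) := by
  -- Taking roots of `d`, `M` and `η` turns every real power into an integer power, so the three
  -- identities become rational.
  obtain ⟨a, ha, rfl⟩ : ∃ a, 0 < a ∧ a ^ 8 = d := ⟨d ^ (1 / 8 : ℝ), by positivity, by
    rw [← Real.rpow_natCast, ← Real.rpow_mul hd.le]; norm_num⟩
  obtain ⟨m, hm, rfl⟩ : ∃ m, 0 < m ∧ m ^ 8 = M := ⟨M ^ (1 / 8 : ℝ), by positivity, by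
    rw [← Real.rpow_natCast, ← Real.rpow_mul hM.le]; norm_num⟩
  obtain ⟨e, he, rfl⟩ : ∃ e, 0 < e ∧ e ^ 2 = η := ⟨η ^ (1 / 2 : ℝ), by positivity, by
    rw [← Real.rpow_natCast, ← Real.rpow_mul hη.le]; norm_num⟩
  have e1 : (e ^ 2) ^ (-(1 / 2) : ℝ) = e⁻¹ := by
    rw [← Real.rpow_natCast, ← Real.rpow_mul he.le, ← Real.rpow_neg_one]
    norm_num
  have e2 : (a ^ 8) ^ (13 / 8 : ℝ) = a ^ 13 := by
    rw [← Real.rpow_natCast, ← Real.rpow_mul ha.le, ← Real.rpow_natCast]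
    norm_num
  have e3 : (m ^ 8) ^ (1 / 8 : ℝ) = m := by
    rw [← Real.rpow_natCast, ← Real.rpow_mul hm.le]
    norm_num
  rw [e1, e2, e3]
  -- That is, `lam = d^(5/8) M^(1/8) η^(-1/2)` and `α = (M / d)^(1/2)`: the latter equalises `α * d`
  -- with `α⁻¹ * M`, the former equalises them with the smoothing error.
  refine ⟨a ^ 5 * m * e⁻¹, m ^ 4 * (a ^ 4)⁻¹, by positivity, by positivity, ?_, ?_, ?_⟩ <;>
    field_simp

/-- Average over the seeds of the sum of the squared bucket variances. -/
lemma IsCollisionPreserving.sum_bucketVar_sq_le {K : Type*} [Fintype K] [Nonempty K] {b : ℝ}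
    {hash : K → Fin n → Fin t} (hb : b ≤ 2) (hh : IsCollisionPreserving b hash)
    {v : Fin n → ℝ} (hv : ∀ j, 0 ≤ v j) :
    (∑ k, ∑ ℓ, bucketVar (hash k) v ℓ ^ 2) / Fintype.card K ≤
      ∑ j, v j ^ 2 + 2 / t * (∑ j, v j) ^ 2 := by
  classical
  have hK : (0 : ℝ) < Fintype.card K := by exact_mod_cast Fintype.card_pos
  -- The squared bucket variances count colliding pairs with weight `v i * v j`, so averaging over
  -- `k` produces collision probabilities.
  have e1 : ∀ k, ∑ ℓ, bucketVar (hash k) v ℓ ^ 2 =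
      ∑ i, ∑ j, v i * v j * if hash k i = hash k j then 1 else 0 := by
    intro k
    have : ∀ ℓ, bucketVar (hash k) v ℓ ^ 2 = ∑ i, ∑ j,
        if hash k i = ℓ then (if hash k j = ℓ then v i * v j else 0) else 0 := fun ℓ => by
      rw [sq, bucketVar, Finset.sum_filter, Finset.sum_mul_sum]
      refine Finset.sum_congr rfl fun i _ => Finset.sum_congr rfl fun j _ => ?_
      split_ifs <;> simp
    simp_rw [this]
    rw [Finset.sum_comm]
    refine Finset.sum_congr rfl fun i _ => ?_
    rw [Finset.sum_comm]
    refine Finset.sum_congr rfl fun j _ => ?_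
    rw [Finset.sum_ite_eq]
    simp [eq_comm]
  have e2 : (∑ k, ∑ ℓ, bucketVar (hash k) v ℓ ^ 2) / Fintype.card K = ∑ i, ∑ j, v i * v j *
      (((Finset.univ.filter fun k => hash k i = hash k j).card : ℝ) / Fintype.card K) := by
    simp_rw [e1]
    rw [Finset.sum_comm, Finset.sum_div]
    refine Finset.sum_congr rfl fun i _ => ?_
    rw [Finset.sum_comm, Finset.sum_div]
    refine Finset.sum_congr rfl fun j _ => ?_
    rw [← Finset.mul_sum, Finset.sum_boole, mul_div_assoc]
  have e3 : ∑ j, v j ^ 2 + 2 / t * (∑ j, v j) ^ 2 =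
      ∑ i, ∑ j, v i * v j * ((if i = j then 1 else 0) + 2 / t) := by
    simp only [mul_add, Finset.sum_add_distrib, mul_ite, mul_one, mul_zero, Finset.sum_ite_eq,
      Finset.mem_univ, if_true, sq, Finset.sum_mul_sum]
    congr 1
    simp only [Finset.mul_sum]
    exact Finset.sum_congr rfl fun i _ => Finset.sum_congr rfl fun j _ => by ring
  rw [e2, e3]
  refine Finset.sum_le_sum fun i _ => Finset.sum_le_sum fun j _ =>
    mul_le_mul_of_nonneg_left ?_ (mul_nonneg (hv i) (hv j))
  -- A diagonal pair always collides, with probability at most 1; a pair of distinct indices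
  -- collides with probability at most `b / t ≤ 2 / t`.
  split_ifs with hij
  · have h1 : ((Finset.univ.filter fun k => hash k i = hash k j).card : ℝ) / Fintype.card K ≤ 1 := by
      rw [div_le_one hK]
      exact_mod_cast Finset.card_le_univ _
    have : (0 : ℝ) ≤ 2 / t := by positivity
    linarith
  · rw [zero_add]
    exact (hh.2 i j hij).trans (by gcongr)

end HashedSample

/-! ### Both sums against the Gaussian -/

section HashedInvariance

variable {n d t : ℕ} {Ω Ω' : Type*} [MeasurableSpace Ω] [MeasurableSpace Ω'] {η : ℝ}

/-- The law of the sum of independent Gaussian vectors is the one of the product measure. -/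
lemma real_sum_mem_eq_pi {R : Measure Ω} {G : Fin n → Ω → EuclideanSpace ℝ (Fin d)}
    {μ : Fin n → Measure (EuclideanSpace ℝ (Fin d))} (hG : iIndepFun G R)
    (hl : ∀ j, HasLaw (G j) (μ j) R) {A : Set (EuclideanSpace ℝ (Fin d))} (hA : MeasurableSet A) :
    R.real {ω | ∑ j, G j ω ∈ A} = (Measure.pi μ).real {x | ∑ j, x j ∈ A} := by
  have hm : AEMeasurable (fun ω j => G j ω) R := aemeasurable_pi_lambda _ fun j => (hl j).aemeasurable
  have h := hG.map_fun_eq_pi_map fun j => (hl j).aemeasurable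
  simp only [(hl _).map_eq] at h
  have hA' : MeasurableSet {x : Fin n → EuclideanSpace ℝ (Fin d) | ∑ j, x j ∈ A} :=
    (by fun_prop : Measurable fun x : Fin n → EuclideanSpace ℝ (Fin d) => ∑ j, x j) hA
  rw [← h, measureReal_def, measureReal_def, Measure.map_apply_of_aemeasurable hm hA']
  rfl

lemma real_mem_eq_of_dim_zero {Ω : Type*} [MeasurableSpace Ω] {P : Measure Ω}
    [IsProbabilityMeasure P] (Z : Ω → EuclideanSpace ℝ (Fin 0))
    (A : Set (EuclideanSpace ℝ (Fin 0))) [Decidable (0 ∈ A)] :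
    P.real {ω | Z ω ∈ A} = if 0 ∈ A then 1 else 0 := by
  have : ∀ ω, Z ω = 0 := fun ω => Subsingleton.elim _ _
  simp only [this]
  split_ifs with h <;> simp [h]

/-- The invariance principle for a hashed sample and for the original variables, against the
Gaussian law. -/
lemma abs_real_sub_gaussian_le_of_hashedSample {b : ℝ} {K : Type*} [Fintype K] [Nonempty K]
    {P : Measure Ω} [IsProbabilityMeasure P] {Q : Measure Ω'} [IsProbabilityMeasure Q]
    {X : Fin n → Ω → EuclideanSpace ℝ (Fin d)} (hXm : ∀ j, Measurable (X j))
    (hXi : iIndepFun X P) (hX : ∀ j, IsHC η (X j) P) (h0 : ∀ j, ∫ ω, X j ω ∂P = 0)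
    (h1 : ∀ i, ∑ j, ∫ ω, (X j ω i) ^ 2 ∂P = 1) {hash : K → Fin n → Fin t} (hb : b ≤ 2)
    (hh : IsCollisionPreserving b hash) {seed : Ω' → K}
    {Y : Fin n → Ω' → EuclideanSpace ℝ (Fin d)} (hY : IsHashedSample hash X P seed Y Q)
    {A : Set (EuclideanSpace ℝ (Fin d))} (hA : IsTranslateOfUnionOfOrthants A) (hd : 0 < d) :
    |Q.real {ω | ∑ j, Y j ω ∈ A} - (Measure.pi fun j =>
        multivariateGaussian 0 (covMat (X j) P)).real {x | ∑ j, x j ∈ A}| ≤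
      (32 + 255 * √(gaussianFourthMoment + 4)) * (η ^ (-(1 / 2) : ℝ) * (d : ℝ) ^ (13 / 8 : ℝ) *
        ((d : ℝ) ^ 2 / t + ∑ j, sqNormL2 (X j) P ^ 2) ^ (1 / 8 : ℝ)) ∧
    |P.real {ω | ∑ j, X j ω ∈ A} - (Measure.pi fun j =>
        multivariateGaussian 0 (covMat (X j) P)).real {x | ∑ j, x j ∈ A}| ≤
      (32 + 255 * √(gaussianFourthMoment + 4)) * (η ^ (-(1 / 2) : ℝ) * (d : ℝ) ^ (13 / 8 : ℝ) *
        ((d : ℝ) ^ 2 / t + ∑ j, sqNormL2 (X j) P ^ 2) ^ (1 / 8 : ℝ)) := by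
  -- The normalisation of the variances fails for an empty sum. An index is what yields the bounds
  -- on `η`, and its hash value shows `t > 0`.
  have hn : Nonempty (Fin n) := by
    by_contra hn
    rw [not_nonempty_iff] at hn
    simpa using h1 ⟨0, hd⟩
  obtain ⟨j₀⟩ := hn
  obtain ⟨k₀⟩ := ‹Nonempty K›
  have : Nonempty K := ⟨k₀⟩
  have hη := (hX j₀).1
  have hη1 := (hX j₀).2.1.le
  have hd' : (0 : ℝ) < d := Nat.cast_pos.2 hd
  have ht' : (0 : ℝ) < t := Nat.cast_pos.2 ((Nat.zero_le _).trans_lt (hash k₀ j₀).2)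
  set v : Fin n → ℝ := fun j => sqNormL2 (X j) P with hv
  have v0 : ∀ j, 0 ≤ v j := fun j => sqNormL2_nonneg _ _
  have sumv : ∑ j, v j = d := by
    simp only [hv, ← (hX _).sum_integral_sq]
    rw [Finset.sum_comm]
    simp [h1]
  set M : ℝ := (d : ℝ) ^ 2 / t + ∑ j, v j ^ 2 with hM
  have V0 : 0 ≤ ∑ j, v j ^ 2 := Finset.sum_nonneg fun j _ => sq_nonneg _
  have M1 : 0 < (d : ℝ) ^ 2 / t := by positivity
  have M0 : 0 < M := by linarith
  obtain ⟨lam, α, hlam, hα, r1, r2, r3⟩ := exists_scale hd' hη M0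
  set B := η ^ (-(1 / 2) : ℝ) * (d : ℝ) ^ (13 / 8 : ℝ) * M ^ (1 / 8 : ℝ) with hB
  set q := √(gaussianFourthMoment + 4) with hq
  have q0 : 0 ≤ q := Real.sqrt_nonneg _
  set γ := Measure.pi fun j => multivariateGaussian 0 (covMat (X j) P) with hγ
  have B0 : 0 ≤ B := by rw [← r1]; positivity
  set c := (d : ℝ) ^ 3 * lam⁻¹ ^ 3 * η⁻¹ ^ 2 with hc
  have c0 : 0 < c := by have := inv_pos.2 hlam; have := inv_pos.2 hη; positivity
  have α0 : 0 < α⁻¹ := inv_pos.2 hα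
  constructor
  · have hA' : MeasurableSet {ω | ∑ j, Y j ω ∈ A} :=
      (Finset.measurable_fun_sum _ fun j _ => hY.measurable j) hA.measurableSet
    have hK : (0 : ℝ) < Fintype.card K := by exact_mod_cast Fintype.card_pos
    have pk : ∀ k, IsProbabilityMeasure (cond Q (seed ⁻¹' {k})) := fun k => by
      refine cond_isProbabilityMeasure fun h => ?_
      have := hY.uniform_seed k
      rw [measureReal_def, h, ENNReal.toReal_zero] at this
      have : 0 < 1 / (Fintype.card K : ℝ) := by positivity
      linarith
    -- `lam` and `α` are the same for all seeds, so the bound depends on `k` only through the sum of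
    -- squared bucket variances.
    have step : ∀ k, |(cond Q (seed ⁻¹' {k})).real {ω | ∑ j, Y j ω ∈ A} -
        γ.real {x | ∑ j, x j ∈ A}| ≤ 32 * B + 85 * q * (B +
          c * α⁻¹ * ∑ ℓ, bucketVar (hash k) v ℓ ^ 2) := fun k => by
      have := abs_real_sub_gaussian_le hX h0 h1 hη hη1 hY.measurable (hY.identDistrib k)
        (hY.fourWise k) (fun s ℓ hℓ => hY.indepFun_bucket_sums k s hℓ) hA hlam hα
      rwa [r1, mul_add, r2, ← mul_assoc c] at this
    have avg : Q.real {ω | ∑ j, Y j ω ∈ A} - γ.real {x | ∑ j, x j ∈ A} =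
        (∑ k, ((cond Q (seed ⁻¹' {k})).real {ω | ∑ j, Y j ω ∈ A} -
          γ.real {x | ∑ j, x j ∈ A})) / Fintype.card K := by
      rw [hY.real_eq_sum_cond hA', Finset.sum_sub_distrib, sub_div, Finset.sum_const,
        Finset.card_univ, nsmul_eq_mul, mul_div_cancel_left₀ _ hK.ne']
    have coll := hh.sum_bucketVar_sq_le hb v0
    rw [sumv] at coll
    have coll2 : (∑ k, ∑ ℓ, bucketVar (hash k) v ℓ ^ 2) / Fintype.card K ≤ 2 * M := by
      have : 2 / (t : ℝ) * (d : ℝ) ^ 2 = 2 * ((d : ℝ) ^ 2 / t) := by ring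
      linarith
    rw [avg, abs_div, abs_of_pos hK]
    calc _ ≤ (∑ k, (32 * B + 85 * q * (B + c * α⁻¹ * ∑ ℓ, bucketVar (hash k) v ℓ ^ 2))) /
          Fintype.card K := by
          gcongr
          exact (Finset.abs_sum_le_sum_abs _ _).trans (Finset.sum_le_sum fun k _ => step k)
      _ = 32 * B + 85 * q * (B + c * α⁻¹ *
          ((∑ k, ∑ ℓ, bucketVar (hash k) v ℓ ^ 2) / Fintype.card K)) := by
          simp only [Finset.sum_add_distrib, ← Finset.mul_sum, Finset.sum_const, Finset.card_univ,
            nsmul_eq_mul]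
          field_simp
      _ ≤ 32 * B + 85 * q * (B + c * α⁻¹ * (2 * M)) := by gcongr
      -- The term with `α` contributes `B` and the term with `α⁻¹` contributes `2 * B`, so 255 = 85
      -- * 3.
      _ = (32 + 255 * q) * B := by
          linear_combination 170 * q * r3
  -- With the identity as hash function every bucket is a single index, so the sum of squared bucket
  -- variances is `∑ v j ^ 2 ≤ M`.
  · have := abs_real_sub_gaussian_le (h := id) hX h0 h1 hη hη1 hXm
      (fun j => IdentDistrib.refl (hXm j).aemeasurable) (fun ℓ => hXi.wiseIndepOn 4 _)
      (fun s ℓ hℓ => hXi.indepFun_bucket_sums hXm id s hℓ) hA hlam hα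
    have bv : ∀ ℓ, bucketVar id v ℓ = v ℓ := fun ℓ => by
      simp [bucketVar, Finset.filter_eq']
    simp only [← hv, bv] at this
    rw [r1, mul_add, r2] at this
    refine this.trans ?_
    calc _ ≤ 32 * B + 85 * q * (B + c * (α⁻¹ * M)) := by
          gcongr
          linarith
      _ = 32 * B + 85 * q * (B + B) := by rw [r3]
      _ ≤ (32 + 255 * q) * B := by nlinarith [mul_nonneg q0 B0]

end HashedInvariance

/-! ### The theorem -/

theorem mainTheorem6 :
    ∃ C : ℝ, 0 < C ∧
      ∀ {n d t : ℕ} {η b : ℝ} {K Ω Ω' : Type*} [Fintype K] [Nonempty K]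
        [MeasurableSpace Ω] [MeasurableSpace Ω']
        (P : Measure Ω) [IsProbabilityMeasure P] (Q : Measure Ω') [IsProbabilityMeasure Q]
        (X : Fin n → Ω → EuclideanSpace ℝ (Fin d)),
        (∀ j, Measurable (X j)) → iIndepFun X P → (∀ j, IsHC η (X j) P) →
        (∀ j, ∫ ω, X j ω ∂P = 0) →
        (∀ i, ∑ j, ∫ ω, (X j ω i) ^ 2 ∂P = 1) →
        ∀ (hash : K → Fin n → Fin t), b ≤ 2 → IsCollisionPreserving b hash →
        ∀ (seed : Ω' → K) (Y : Fin n → Ω' → EuclideanSpace ℝ (Fin d)),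
        IsHashedSample hash X P seed Y Q →
        ∀ A : Set (EuclideanSpace ℝ (Fin d)), IsTranslateOfUnionOfOrthants A →
        (∀ {Ω'' : Type*} [MeasurableSpace Ω''] (R : Measure Ω'') [IsProbabilityMeasure R]
          (G : Fin n → Ω'' → EuclideanSpace ℝ (Fin d)),
          iIndepFun G R →
          (∀ j, HasLaw (G j) (multivariateGaussian 0 (covMat (X j) P)) R) →
          |Q.real {ω | ∑ j, Y j ω ∈ A} - R.real {ω | ∑ j, G j ω ∈ A}| ≤
            C * η ^ (-(1 / 2) : ℝ) * (d : ℝ) ^ (13 / 8 : ℝ) *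
              ((d : ℝ) ^ 2 / t + ∑ j, sqNormL2 (X j) P ^ 2) ^ (1 / 8 : ℝ)) ∧
        |P.real {ω | ∑ j, X j ω ∈ A} - Q.real {ω | ∑ j, Y j ω ∈ A}| ≤
          C * η ^ (-(1 / 2) : ℝ) * (d : ℝ) ^ (13 / 8 : ℝ) *
            ((d : ℝ) ^ 2 / t + ∑ j, sqNormL2 (X j) P ^ 2) ^ (1 / 8 : ℝ) := by
  classical
  have q0 : 0 ≤ √(gaussianFourthMoment + 4) := Real.sqrt_nonneg _
  -- The factor 2 pays for the triangle inequality through the Gaussian in the second estimate.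
  refine ⟨2 * (32 + 255 * √(gaussianFourthMoment + 4)), by positivity, ?_⟩
  intro n d t η b K Ω Ω' _ _ _ _ P _ Q _ X hXm hXi hX h0 h1 hash hb hh seed Y hY A hA
  -- In dimension zero there may be no summands and then `η` is unconstrained, so this case is
  -- separate: the space is a single point and both sides vanish.
  rcases Nat.eq_zero_or_pos d with rfl | hd
  · have z : ((0 : ℕ) : ℝ) ^ (13 / 8 : ℝ) = 0 := by
      rw [Nat.cast_zero, Real.zero_rpow (by norm_num)]
    refine ⟨fun R _ G _ _ => ?_, ?_⟩ <;>
      simp only [real_mem_eq_of_dim_zero, z, mul_zero, zero_mul, sub_self, abs_zero, le_refl]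
  obtain ⟨hT, hS⟩ := abs_real_sub_gaussian_le_of_hashedSample hXm hXi hX h0 h1 hb hh hY hA hd
  rw [mul_assoc, mul_assoc, ← mul_assoc (η ^ _)]
  set B := η ^ (-(1 / 2) : ℝ) * (d : ℝ) ^ (13 / 8 : ℝ) *
    ((d : ℝ) ^ 2 / t + ∑ j, sqNormL2 (X j) P ^ 2) ^ (1 / 8 : ℝ)
  refine ⟨fun R _ G hG hl => ?_, ?_⟩
  · rw [real_sum_mem_eq_pi hG hl hA.measurableSet]
    linarith [(abs_nonneg _).trans hT]
  · rw [abs_le] at *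
    constructor <;> linarith [hT.1, hT.2, hS.1, hS.2]
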